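/- Let $n\ge 1$. For an $n\times n$ complex matrix $M$ with no zero entry let $M^{(-)}$ be its entrywise inverse, $(M^{(-)})_{ij}=1/M_{ij}$; let $\circ$ denote the entrywise product, and on $n\times n$ complex matrices put $X_A(M)=AM$ and $\Delta_B(M)=B\circ M$. The pair $(A,B)$ is a one-sided Jones pair if $X_A$ and $\Delta_B$ are invertible and $X_A\Delta_BX_A=\Delta_BX_A\Delta_B$; it is a Jones pair if both $(A,B)$ and $(A,B^T)$ are one-sided Jones pairs; a Jones pair is invertible if $A$ has no zero entry and $B$ is invertible. For a square complex matrix $M$ without zero entries, the Nomura algebra $\mathcal N_M$ is the set of all matrices of the same size for which every vector $Me_i\circ M^{(-)}e_j$ is an eigenvector. An association scheme on a nonempty finite set is a finite set $\mathcal A$ of nonzero $01$-matrices indexed by that set which contains $I$, sums to the all-ones matrix, is closed under transpose, and whose members commute with each other and have all pairwise products in the linear span of $\mathcal A$ (its Bose--Mesner algebra). For a nonempty index subset $Y$, $M_Y$ is the submatrix of $M$ on the rows and columns in $Y$; if the set of nonzero matrices among $\{M_Y: M\in\mathcal A\}$ is an association scheme, it is called the induced scheme of $\mathcal A$ on $Y$.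 **Theorem.** Let $(A,B)$ be an invertible Jones pair of $n\times n$ complex matrices with $A$ symmetric, let $d\in\mathbb C$ with $d^2=n$, and let $$W=\begin{pmatrix}A^T&-A^T\\ (B^{(-)})^T&(B^{(-)})^T\end{pmatrix},\qquad V=\begin{pmatrix} dA&-dA&B^{(-)}&B^{(-)}\\ -dA&dA&B^{(-)}&B^{(-)}\\ (B^{(-)})^T&(B^{(-)})^T&dA&-dA\\ (B^{(-)})^T&(B^{(-)})^T&-dA&dA\end{pmatrix}.$$ Put $Y=\{1,\dots,2n\}$ and $U=\{2n+1,\dots,4n\}$, and identify both with the index set of $W$ in the order-preserving way. Then $$\{M_Y: M\in\mathcal N_V\}=\mathcal N_{W^T}=\{M_U: M\in\mathcal N_V\}.$$ Moreover, $\mathcal N_V$ and $\mathcal N_{W^T}$ are the Bose--Mesner algebras of association schemes $\mathcal V$ and $\mathcal W$, and $\mathcal W$ is the induced scheme of $\mathcal V$ both on $Y$ and on $U$. -/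

import Mathlib

namespace JonesPair

open Matrix

variable {ι κ : Type*}

/-- The Schur (entrywise) inverse `A⁽⁻⁾`; it is only meaningful when all entries are nonzero. -/
noncomputable def schurInv (A : Matrix ι κ ℂ) : Matrix ι κ ℂ :=
  Matrix.of fun i j => (A i j)⁻¹

/-- `A` is Schur-invertible: every entry is nonzero. -/
def IsSchurInvertible (A : Matrix ι κ ℂ) : Prop :=
  ∀ i j, A i j ≠ 0

/-- The operator `X_A : M ↦ A M` on square matrices. -/
def opX [Fintype ι] (A : Matrix ι ι ℂ) : Module.End ℂ (Matrix ι ι ℂ) where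
  toFun M := A * M
  map_add' M N := Matrix.mul_add A M N
  map_smul' c M := Matrix.mul_smul A c M

/-- The operator `Δ_B : M ↦ B ∘ M` (Schur product) on square matrices. -/
def opDelta (B : Matrix ι ι ℂ) : Module.End ℂ (Matrix ι ι ℂ) where
  toFun M := B ⊙ M
  map_add' M N := Matrix.hadamard_add B M N
  map_smul' c M := Matrix.hadamard_smul B M c

/-- One-sided Jones pair: `X_A`, `Δ_B` are invertible and satisfy the braid relation. -/
structure IsOneSidedJonesPair [Fintype ι] (A B : Matrix ι ι ℂ) : Prop where
  isUnit_opX : IsUnit (opX A)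
  isUnit_opDelta : IsUnit (opDelta B)
  braid : opX A * opDelta B * opX A = opDelta B * opX A * opDelta B

/-- Jones pair: both `(A, B)` and `(A, Bᵀ)` are one-sided Jones pairs. -/
structure IsJonesPair [Fintype ι] (A B : Matrix ι ι ℂ) : Prop where
  left : IsOneSidedJonesPair A B
  right : IsOneSidedJonesPair A Bᵀ

/-- Invertible Jones pair: a Jones pair with `A` Schur-invertible and `B` invertible. -/
structure IsInvertibleJonesPair [Fintype ι] [DecidableEq ι] (A B : Matrix ι ι ℂ) : Prop where
  isJonesPair : IsJonesPair A B
  isSchurInvertible : IsSchurInvertible A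
  isUnit : IsUnit B

/-- The vector `A e_i ∘ A⁽⁻⁾ e_j`. -/
noncomputable def nomuraVec (A : Matrix ι ι ℂ) (i j : ι) : ι → ℂ :=
  fun k => A k i * schurInv A k j

/-- The Nomura algebra `N_A`: all matrices having every `A e_i ∘ A⁽⁻⁾ e_j` as an eigenvector. -/
noncomputable def nomura [Fintype ι] [DecidableEq ι] (A : Matrix ι ι ℂ) :
    Subalgebra ℂ (Matrix ι ι ℂ) where
  carrier := {M | ∀ i j, ∃ c : ℂ, M *ᵥ nomuraVec A i j = c • nomuraVec A i j}
  mul_mem' := by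
    intro M N hM hN i j
    obtain ⟨a, ha⟩ := hM i j
    obtain ⟨b, hb⟩ := hN i j
    refine ⟨b * a, ?_⟩
    rw [← Matrix.mulVec_mulVec, hb, Matrix.mulVec_smul, ha, smul_smul]
  add_mem' := by
    intro M N hM hN i j
    obtain ⟨a, ha⟩ := hM i j
    obtain ⟨b, hb⟩ := hN i j
    exact ⟨a + b, by rw [Matrix.add_mulVec, ha, hb, add_smul]⟩
  algebraMap_mem' := by
    intro c i j
    exact ⟨c, by rw [Algebra.algebraMap_eq_smul_one, Matrix.smul_mulVec, Matrix.one_mulVec]⟩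

/-- The `2n × 2n` matrix `W` of a pair `(A, B)` with `A` symmetric. -/
noncomputable def matW (A B : Matrix ι ι ℂ) : Matrix (ι ⊕ ι) (ι ⊕ ι) ℂ :=
  Matrix.fromBlocks Aᵀ (-Aᵀ) (schurInv B)ᵀ (schurInv B)ᵀ

/-- The `4n × 4n` matrix `V`. The four groups of rows and columns are, in order, `inl ∘ inl`,
`inl ∘ inr`, `inr ∘ inl` and `inr ∘ inr`; so `{1, …, 2n}` is the range of `inl` and
`{2n + 1, …, 4n}` the range of `inr`. -/
noncomputable def matV (d : ℂ) (A B : Matrix ι ι ℂ) :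
    Matrix ((ι ⊕ ι) ⊕ (ι ⊕ ι)) ((ι ⊕ ι) ⊕ (ι ⊕ ι)) ℂ :=
  Matrix.fromBlocks
    (Matrix.fromBlocks (d • A) (-(d • A)) (-(d • A)) (d • A))
    (Matrix.fromBlocks (schurInv B) (schurInv B) (schurInv B) (schurInv B))
    (Matrix.fromBlocks (schurInv B)ᵀ (schurInv B)ᵀ (schurInv B)ᵀ (schurInv B)ᵀ)
    (Matrix.fromBlocks (d • A) (-(d • A)) (-(d • A)) (d • A))

/-- A (commutative) association scheme, as the finite set of its (nonzero, hence distinct)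
adjacency matrices. -/
structure IsAssociationScheme [Fintype ι] [DecidableEq ι]
    (𝒜 : Finset (Matrix ι ι ℂ)) : Prop where
  zero_or_one : ∀ M ∈ 𝒜, ∀ i j, M i j = 0 ∨ M i j = 1
  ne_zero : ∀ M ∈ 𝒜, M ≠ 0
  one_mem : (1 : Matrix ι ι ℂ) ∈ 𝒜
  sum_eq : ∑ M ∈ 𝒜, M = Matrix.of fun _ _ => (1 : ℂ)
  transpose_mem : ∀ M ∈ 𝒜, Mᵀ ∈ 𝒜
  mul_mem_span : ∀ M ∈ 𝒜, ∀ N ∈ 𝒜, M * N ∈ Submodule.span ℂ (𝒜 : Set (Matrix ι ι ℂ))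
  mul_comm : ∀ M ∈ 𝒜, ∀ N ∈ 𝒜, M * N = N * M

/-- `𝒜` is an association scheme whose Bose–Mesner algebra (the span of `𝒜`) is `S`. -/
def IsSchemeOf [Fintype ι] [DecidableEq ι] (𝒜 : Finset (Matrix ι ι ℂ))
    (S : Subalgebra ℂ (Matrix ι ι ℂ)) : Prop :=
  IsAssociationScheme 𝒜 ∧
    Submodule.span ℂ (𝒜 : Set (Matrix ι ι ℂ)) = Subalgebra.toSubmodule S

/-- The matrix `M_Y`, where `Y` is the range of `f` and its elements are labelled through `f`. -/
def restrict (f : κ ↪ ι) (M : Matrix ι ι ℂ) : Matrix κ κ ℂ :=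
  M.submatrix f f

/-- The scheme `ℬ` is the induced scheme of `𝒜` on the nonempty set `Y`, the range of `f`:
it consists of the nonzero restrictions `M_Y` of the matrices of `𝒜`. -/
structure IsInducedScheme [Fintype ι] [DecidableEq ι] [Fintype κ] [DecidableEq κ]
    (𝒜 : Finset (Matrix ι ι ℂ)) (f : κ ↪ ι) (ℬ : Finset (Matrix κ κ ℂ)) : Prop where
  nonempty : Nonempty κ
  scheme : IsAssociationScheme 𝒜
  induced : IsAssociationScheme ℬ
  eq_restrict : (ℬ : Set (Matrix κ κ ℂ)) = (restrict f '' (𝒜 : Set (Matrix ι ι ℂ))) \ {0}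

end JonesPair

/-! Call `M` a solution for `(A, B)` with eigenvalue matrix `S` when `M` sends each `A e_l ∘ B e_j`
to `S l j` times itself (`IsEigen`). The braid relation says that `A` is a solution for `(A, B)`
with eigenvalue matrix `B`, and invertibility of the pair forces `A` and `B` to be type II.

The engine is the exchange `isEigen_hadamard_iff`. Since `A` is one solution, `A ∘ K` is a solution
with eigenvalue matrix `P * B` exactly when `P ∈ N_A` has eigenvalue matrix `Kᵀ`, and with
eigenvalue matrix `B * Qᵀ` exactly when `Q ∈ N_{Bᵀ}` has eigenvalue matrix `Kᵀ`. Hence `Q ↦ B Qᵀ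
B⁻¹` carries `N_{Bᵀ}` onto `N_A` and keeps eigenvalue matrices. With the duality between `N_M` and
`N_{Mᵀ}` this gives `N_A = N_B`.

The Nomura vectors of `Wᵀ` have the form `(v, v)` or `(v, -v)`, and those of `V` consist of such a
vector in each half. So `N_{Wᵀ}` consists of the matrices acting as some `F ∈ N_A` on the `(v, v)`
and as some solution `G` for `(A, B)` on the `(v, -v)`. Changing one sign in `V` changes the
relative sign of the two halves of a Nomura vector; subtraction then shows that restrictions of
`N_V` lie in `N_{Wᵀ}`. Conversely `(F, G)` extends to a block diagonal member of `N_V` whose second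
block comes from `F' = B⁻¹ F B` and a `G'` found by exchange (`exists_extension_symm`,
`exists_extension_skew`). Swapping the halves of `V` replaces `B` by `Bᵀ`, which leaves `N_{Wᵀ}`
unchanged.

For type-II matrices the Nomura algebra is commutative, contains the all-ones matrix and is closed
under transpose and Schur product. Its scheme consists of the indicators of the classes of positions
its members cannot separate, and these classes are compatible with restriction. -/

set_option linter.unusedSectionVars false

namespace JonesPair

open Matrix

/-! ### Schur idempotents, association schemes and restriction -/

section SchurClasses

variable {ι κ : Type*} [Fintype ι] [DecidableEq ι] [Fintype κ] [DecidableEq κ]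

open Classical in
/-- The `01`-matrix supported on the positions at which every matrix of `S` takes the value it
takes at the position `x`. -/
noncomputable def schurClass (S : Set (Matrix ι ι ℂ)) (x : ι × ι) : Matrix ι ι ℂ :=
  Matrix.of fun i j => if ∀ M ∈ S, M i j = M x.1 x.2 then 1 else 0

open Classical in
/-- The primitive Schur idempotents of a Schur-closed space of matrices. -/
noncomputable def schurIdempotents (S : Set (Matrix ι ι ℂ)) : Finset (Matrix ι ι ℂ) :=
  Finset.univ.image (schurClass S)

lemma schurClass_self (S : Set (Matrix ι ι ℂ)) (i j : ι) : schurClass S (i, j) i j = 1 := by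
  simp [schurClass]

lemma schurClass_eq_iff (S : Set (Matrix ι ι ℂ)) (x y : ι × ι) :
    schurClass S x = schurClass S y ↔ ∀ M ∈ S, M x.1 x.2 = M y.1 y.2 := by
  constructor
  · intro h
    have h1 := congrFun (congrFun h x.1) x.2
    by_contra h2
    simp [schurClass, h2] at h1
  · intro h
    ext i j
    have : (∀ M ∈ S, M i j = M x.1 x.2) ↔ ∀ M ∈ S, M i j = M y.1 y.2 :=
      forall₂_congr fun M hM => by rw [h M hM]
    simp only [schurClass, of_apply]
    by_cases hx : ∀ M ∈ S, M i j = M x.1 x.2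
    · rw [if_pos hx, if_pos (this.1 hx)]
    · rw [if_neg hx, if_neg (mt this.2 hx)]

open Classical in
lemma apply_of_mem_schurIdempotents {S : Set (Matrix ι ι ℂ)} {N : Matrix ι ι ℂ}
    (hN : N ∈ schurIdempotents S) (i j : ι) :
    N i j = if N = schurClass S (i, j) then 1 else 0 := by
  obtain ⟨x, -, rfl⟩ := Finset.mem_image.1 hN
  have := schurClass_eq_iff S (i, j) x
  rw [eq_comm] at this
  simp only [this]
  rfl

lemma schurClass_mem_schurIdempotents (S : Set (Matrix ι ι ℂ)) (x : ι × ι) :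
    schurClass S x ∈ schurIdempotents S :=
  Finset.mem_image_of_mem _ (Finset.mem_univ x)

lemma sum_smul_schurIdempotents (S : Set (Matrix ι ι ℂ)) (c : Matrix ι ι ℂ → ℂ) (i j : ι) :
    (∑ N ∈ schurIdempotents S, c N • N) i j = c (schurClass S (i, j)) := by
  classical
  rw [Matrix.sum_apply, Finset.sum_congr rfl (g := fun N =>
    if N = schurClass S (i, j) then c N else 0)]
  · simp [schurClass_mem_schurIdempotents]
  · intro N hN
    rw [Matrix.smul_apply, apply_of_mem_schurIdempotents hN]
    simp

lemma mem_span_schurIdempotents (S : Set (Matrix ι ι ℂ)) {M : Matrix ι ι ℂ} (hM : M ∈ S) :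
    M ∈ Submodule.span ℂ (schurIdempotents S : Set (Matrix ι ι ℂ)) := by
  classical
  rcases isEmpty_or_nonempty ι with _ | _
  · rw [Subsingleton.elim M 0]
    exact Submodule.zero_mem _
  -- `M` is constant on each class, so its value at any representative is the coefficient.
  let r := Function.invFun (schurClass S)
  have h : M = ∑ N ∈ schurIdempotents S, M (r N).1 (r N).2 • N := by
    ext i j
    rw [sum_smul_schurIdempotents S (fun N => M (r N).1 (r N).2)]
    have : schurClass S (r (schurClass S (i, j))) = schurClass S (i, j) :=
      Function.invFun_eq ⟨_, rfl⟩
    exact ((schurClass_eq_iff S _ _).1 this M hM).symm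
  rw [h]
  exact Submodule.sum_mem _ fun N hN => Submodule.smul_mem _ _ (Submodule.subset_span hN)

/-- A subspace that contains the all-ones matrix and is closed under the Schur product contains
the indicators of its classes. -/
lemma schurClass_mem (S : Submodule ℂ (Matrix ι ι ℂ))
    (hJ : (Matrix.of fun _ _ => (1 : ℂ)) ∈ S) (hH : ∀ M ∈ S, ∀ N ∈ S, M ⊙ N ∈ S) (x : ι × ι) :
    schurClass (S : Set (Matrix ι ι ℂ)) x ∈ S := by
  classical
  have key : ∀ t : Finset (ι × ι), ∃ g ∈ S, g x.1 x.2 = 1 ∧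
      ∀ y ∈ t, (¬ ∀ M ∈ S, M y.1 y.2 = M x.1 x.2) → g y.1 y.2 = 0 := by
    intro t
    induction t using Finset.induction_on with
    | empty => exact ⟨_, hJ, rfl, by simp⟩
    | insert y t _ ih =>
      obtain ⟨g, hg, hgx, hgt⟩ := ih
      by_cases hy : ∀ M ∈ S, M y.1 y.2 = M x.1 x.2
      · refine ⟨g, hg, hgx, fun z hz hzx => ?_⟩
        rcases Finset.mem_insert.1 hz with rfl | hz
        · exact absurd hy hzx
        · exact hgt z hz hzx
      · have hy' := hy
        push Not at hy
        obtain ⟨f, hf, hne⟩ := hy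
        have hne' : f x.1 x.2 - f y.1 y.2 ≠ 0 := sub_ne_zero.2 (Ne.symm hne)
        -- A Lagrange interpolation factor: 1 at `x`, 0 at `y`, and harmless at the zeros already
        -- obtained.
        refine ⟨g ⊙ ((f x.1 x.2 - f y.1 y.2)⁻¹ •
          (f - f y.1 y.2 • (Matrix.of fun _ _ => (1 : ℂ)))),
          hH _ hg _ (S.smul_mem _ (S.sub_mem hf (S.smul_mem _ hJ))), ?_, ?_⟩
        · simp [hgx, hne']
        · intro z hz hzx
          rcases Finset.mem_insert.1 hz with rfl | hz
          · simp
          · simp [hgt z hz hzx]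
  obtain ⟨g, hg, hgx, hgt⟩ := key Finset.univ
  convert hg
  ext i j
  by_cases h : ∀ M ∈ S, M i j = M x.1 x.2
  · have := h g hg
    simp only [schurClass, of_apply, SetLike.mem_coe]
    rw [if_pos h, this, hgx]
  · simp only [schurClass, of_apply, SetLike.mem_coe]
    rw [if_neg h, hgt (i, j) (Finset.mem_univ _) h]

/-- A commutative matrix algebra closed under transpose and the Schur product and containing the
all-ones matrix is the Bose–Mesner algebra of an association scheme. -/
theorem isSchemeOf_schurIdempotents [Nonempty ι] (S : Subalgebra ℂ (Matrix ι ι ℂ))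
    (hJ : (Matrix.of fun _ _ => (1 : ℂ)) ∈ S) (hH : ∀ M ∈ S, ∀ N ∈ S, M ⊙ N ∈ S)
    (hT : ∀ M ∈ S, Mᵀ ∈ S) (hC : ∀ M ∈ S, ∀ N ∈ S, M * N = N * M) :
    IsSchemeOf (schurIdempotents (S : Set (Matrix ι ι ℂ))) S := by
  classical
  have hmem : ∀ x, schurClass (S : Set (Matrix ι ι ℂ)) x ∈ S :=
    schurClass_mem (Subalgebra.toSubmodule S) hJ hH
  have hmem' : ∀ M ∈ schurIdempotents (S : Set (Matrix ι ι ℂ)), M ∈ S := by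
    intro M hM
    obtain ⟨x, -, rfl⟩ := Finset.mem_image.1 hM
    exact hmem x
  have hspan : Submodule.span ℂ (schurIdempotents (S : Set (Matrix ι ι ℂ)) :
      Set (Matrix ι ι ℂ)) = Subalgebra.toSubmodule S :=
    le_antisymm (Submodule.span_le.2 hmem') fun M hM => mem_span_schurIdempotents _ hM
  refine ⟨⟨?_, ?_, ?_, ?_, ?_, ?_, fun M hM N hN => hC M (hmem' M hM) N (hmem' N hN)⟩, hspan⟩
  · intro M hM i j
    rw [apply_of_mem_schurIdempotents hM]
    split_ifs <;> simp
  · intro M hM h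
    obtain ⟨x, -, rfl⟩ := Finset.mem_image.1 hM
    have := schurClass_self (S : Set (Matrix ι ι ℂ)) x.1 x.2
    rw [Prod.mk.eta, h] at this
    simp at this
  · obtain ⟨i₀⟩ := ‹Nonempty ι›
    -- The diagonal part `M ∘ I` lies in `S`, and commuting with the all-ones matrix makes it
    -- scalar.
    have hdiag : ∀ M ∈ S, ∀ i, M i i = M i₀ i₀ := by
      intro M hM i
      have h := congrFun (congrFun (hC _ (hH M hM 1 S.one_mem) _ hJ) i) i₀
      simpa [Matrix.mul_apply, Matrix.one_apply, hadamard_apply] using h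
    have : (1 : Matrix ι ι ℂ) = schurClass (S : Set (Matrix ι ι ℂ)) (i₀, i₀) := by
      ext i j
      by_cases hij : i = j
      · subst hij
        simp only [schurClass, of_apply, SetLike.mem_coe]
        rw [if_pos fun M hM => hdiag M hM i, one_apply_eq]
      · simp only [schurClass, of_apply, SetLike.mem_coe]
        rw [if_neg, one_apply_ne hij]
        intro h
        have := h 1 S.one_mem
        simp [one_apply_ne hij] at this
    rw [this]
    exact schurClass_mem_schurIdempotents _ _
  · ext i j
    have := sum_smul_schurIdempotents (S : Set (Matrix ι ι ℂ)) (fun _ => 1) i j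
    simpa using this
  · intro M hM
    obtain ⟨x, -, rfl⟩ := Finset.mem_image.1 hM
    have : (schurClass (S : Set (Matrix ι ι ℂ)) x)ᵀ =
        schurClass (S : Set (Matrix ι ι ℂ)) (x.2, x.1) := by
      ext i j
      have h : (∀ M ∈ (S : Set (Matrix ι ι ℂ)), M j i = M x.1 x.2) ↔
          ∀ M ∈ (S : Set (Matrix ι ι ℂ)), M i j = M x.2 x.1 :=
        ⟨fun h M hM => h Mᵀ (hT M hM), fun h M hM => h Mᵀ (hT M hM)⟩
      simp only [schurClass, of_apply, transpose_apply, h]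
    rw [this]
    exact schurClass_mem_schurIdempotents _ _
  · intro M hM N hN
    rw [hspan]
    exact S.mul_mem (hmem' M hM) (hmem' N hN)

/-- Restricting the matrices of `S` to a subset restricts their Schur idempotents. -/
lemma schurIdempotents_restrict_image (S : Set (Matrix ι ι ℂ)) (T : Set (Matrix κ κ ℂ))
    (f : κ ↪ ι) (h : restrict f '' S = T) :
    (schurIdempotents T : Set (Matrix κ κ ℂ)) =
      (restrict f '' (schurIdempotents S : Set (Matrix ι ι ℂ))) \ {0} := by
  classical
  have hres : ∀ x : κ × κ, restrict f (schurClass S (f x.1, f x.2)) = schurClass T x := by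
    intro x
    ext i j
    have : (∀ M ∈ S, M (f i) (f j) = M (f x.1) (f x.2)) ↔ ∀ M ∈ T, M i j = M x.1 x.2 := by
      rw [← h, Set.forall_mem_image]
      rfl
    simp only [schurClass, restrict, submatrix_apply, of_apply, this]
  ext N
  constructor
  · intro hN
    obtain ⟨x, -, rfl⟩ := Finset.mem_image.1 hN
    refine ⟨⟨_, schurClass_mem_schurIdempotents S _, hres x⟩, fun h0 => ?_⟩
    have := schurClass_self T x.1 x.2
    rw [Prod.mk.eta, Set.mem_singleton_iff.1 h0] at this
    simp at this
  · rintro ⟨⟨M, hM, rfl⟩, h0⟩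
    have : ∃ i j, restrict f M i j ≠ 0 := by
      by_contra hcon
      push Not at hcon
      exact h0 (Matrix.ext hcon)
    obtain ⟨i, j, hij⟩ := this
    -- Distinct idempotents have disjoint supports, so one nonzero entry inside the subset
    -- identifies `M`.
    have hM' : M = schurClass S (f i, f j) := by
      by_contra hne
      apply hij
      simp only [restrict, submatrix_apply]
      rw [apply_of_mem_schurIdempotents hM, if_neg hne]
    rw [hM', hres (i, j)]
    exact schurClass_mem_schurIdempotents _ _

end SchurClasses

/-! ### Eigenvalue matrices and Nomura algebras of type-II matrices -/

section TypeII

variable {ι : Type*}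

lemma IsSchurInvertible.transpose {A : Matrix ι ι ℂ} (h : IsSchurInvertible A) :
    IsSchurInvertible Aᵀ := fun i j => h j i

lemma isSchurInvertible_schurInv {A : Matrix ι ι ℂ} (h : IsSchurInvertible A) :
    IsSchurInvertible (schurInv A) := fun i j => inv_ne_zero (h i j)

variable [Fintype ι] [DecidableEq ι]

/-- Every vector `A e_l ∘ B e_j` is an eigenvector of `M`, with eigenvalue `S l j`. -/
def IsEigen (A B M S : Matrix ι ι ℂ) : Prop :=
  ∀ k l j, ∑ m, M k m * (A m l * B m j) = S l j * (A k l * B k j)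

lemma IsEigen.swap {A B M S : Matrix ι ι ℂ} (h : IsEigen A B M S) : IsEigen B A M Sᵀ := by
  intro k l j
  rw [transpose_apply, mul_comm (B k l), ← h k j l]
  exact Finset.sum_congr rfl fun m _ => by ring

lemma isEigen_iff_col {A B M S : Matrix ι ι ℂ} : IsEigen A B M S ↔
    ∀ j, M * diagonal (fun m => B m j) * A =
      diagonal (fun m => B m j) * A * diagonal (fun l => S l j) := by
  have key : ∀ k l j, ((M * diagonal (fun m => B m j) * A) k l =
      (diagonal (fun m => B m j) * A * diagonal (fun l => S l j)) k l) ↔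
      ∑ m, M k m * (A m l * B m j) = S l j * (A k l * B k j) := by
    intro k l j
    rw [mul_diagonal, diagonal_mul, mul_apply]
    simp only [mul_diagonal]
    rw [show B k j * A k l * S l j = S l j * (A k l * B k j) by ring]
    simp only [mul_assoc, mul_comm (B _ j)]
  exact ⟨fun h j => by ext k l; exact (key k l j).2 (h k l j),
    fun h k l j => (key k l j).1 (by rw [h j])⟩

lemma isEigen_iff_row {A B M S : Matrix ι ι ℂ} : IsEigen A B M S ↔
    ∀ k, Bᵀ * diagonal (M k) * A = diagonal (B k) * Sᵀ * diagonal (A k) := by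
  have key : ∀ k l j, ((Bᵀ * diagonal (M k) * A) j l =
      (diagonal (B k) * Sᵀ * diagonal (A k)) j l) ↔
      ∑ m, M k m * (A m l * B m j) = S l j * (A k l * B k j) := by
    intro k l j
    rw [mul_diagonal, diagonal_mul, mul_apply]
    simp only [mul_diagonal, transpose_apply]
    rw [show B k j * S l j * A k l = S l j * (A k l * B k j) by ring]
    rw [Finset.sum_congr rfl fun m _ => show B m j * M k m * A m l = M k m * (A m l * B m j)
      by ring]
  exact ⟨fun h k => by ext j l; exact (key k l j).2 (h k l j),
    fun h k l j => (key k l j).1 (by rw [h k])⟩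

/-- Lets the diagonal factors in the column and row forms of `IsEigen` be cancelled. Fixing `j`
diagonalises `M`; fixing `k` uses a single row of `M`, and passing between the two forms drives
duality and exchange. -/
lemma isUnit_diagonal_of_ne_zero {v : ι → ℂ} (h : ∀ i, v i ≠ 0) : IsUnit (diagonal v) := by
  rw [isUnit_diagonal, Pi.isUnit_iff]
  exact fun i => (h i).isUnit

lemma IsEigen.mul {A B M N S T : Matrix ι ι ℂ} (h : IsEigen A B M S) (h' : IsEigen A B N T) :
    IsEigen A B (M * N) (S ⊙ T) := by
  rw [isEigen_iff_col] at *
  intro j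
  have : diagonal (fun l => (S ⊙ T) l j) =
      diagonal (fun l => S l j) * diagonal (fun l => T l j) := by
    rw [diagonal_mul_diagonal]; rfl
  rw [this, Matrix.mul_assoc M, Matrix.mul_assoc M, h' j, ← Matrix.mul_assoc, ← Matrix.mul_assoc,
    h j]
  simp only [Matrix.mul_assoc]

lemma IsEigen.smul {A B M S : Matrix ι ι ℂ} (h : IsEigen A B M S) (c : ℂ) :
    IsEigen A B (c • M) (c • S) := by
  intro k l j
  simp only [Matrix.smul_apply, smul_eq_mul, mul_assoc]
  rw [← Finset.mul_sum, h k l j]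

lemma IsEigen.of_smul {A B M S : Matrix ι ι ℂ} {c : ℂ} (hc : c ≠ 0)
    (h : IsEigen A B (c • M) (c • S)) : IsEigen A B M S := by
  have := h.smul c⁻¹
  rwa [smul_smul, smul_smul, inv_mul_cancel₀ hc, one_smul, one_smul] at this

/-- A matrix is determined by its eigenvalues on the vectors `A e_l ∘ B e_j`. -/
lemma IsEigen.left_injective {A B M N S : Matrix ι ι ℂ} (hA : IsUnit A)
    (hB : IsSchurInvertible B) (h : IsEigen A B M S) (h' : IsEigen A B N S) : M = N := by
  rw [isEigen_iff_col] at h h'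
  ext k m
  -- One column of `B` suffices; `k` is merely an index at hand.
  have h1 := (h k).trans (h' k).symm
  rw [hA.mul_left_inj, (isUnit_diagonal_of_ne_zero fun m => hB m k).mul_left_inj] at h1
  rw [h1]

lemma mem_nomura_iff {M F : Matrix ι ι ℂ} :
    F ∈ nomura M ↔ ∃ S, IsEigen M (schurInv M) F S := by
  constructor
  · intro h
    choose c hc using (h : ∀ i j, ∃ c : ℂ, F *ᵥ nomuraVec M i j = c • nomuraVec M i j)
    exact ⟨Matrix.of c, fun k l j => congrFun (hc l j) k⟩
  · rintro ⟨S, hS⟩ i j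
    exact ⟨S i j, funext fun k => hS k i j⟩

/-- Type-II matrices: no zero entry, and the Schur inverse is a multiple of the inverse
transpose. -/
structure IsTypeII (M : Matrix ι ι ℂ) : Prop where
  schur : IsSchurInvertible M
  gram : Mᵀ * schurInv M = (Fintype.card ι : ℂ) • (1 : Matrix ι ι ℂ)

variable {M : Matrix ι ι ℂ}

lemma IsTypeII.schurInv_mul_transpose (h : IsTypeII M) :
    schurInv M * Mᵀ = (Fintype.card ι : ℂ) • (1 : Matrix ι ι ℂ) := by
  rcases isEmpty_or_nonempty ι with _ | _
  · exact Subsingleton.elim _ _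
  have hn : (Fintype.card ι : ℂ) ≠ 0 := Nat.cast_ne_zero.2 Fintype.card_ne_zero
  have h1 : Mᵀ * ((Fintype.card ι : ℂ)⁻¹ • schurInv M) = 1 := by
    rw [Matrix.mul_smul, h.gram, smul_smul, inv_mul_cancel₀ hn, one_smul]
  have h2 := mul_eq_one_comm.1 h1
  rw [Matrix.smul_mul] at h2
  rw [← h2, smul_smul, mul_inv_cancel₀ hn, one_smul]

lemma IsTypeII.isUnit (h : IsTypeII M) : IsUnit M := by
  rcases isEmpty_or_nonempty ι with _ | _
  · rw [Subsingleton.elim M 1]; exact isUnit_one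
  have hn : (Fintype.card ι : ℂ) ≠ 0 := Nat.cast_ne_zero.2 Fintype.card_ne_zero
  have h1 : Mᵀ * ((Fintype.card ι : ℂ)⁻¹ • schurInv M) = 1 := by
    rw [Matrix.mul_smul, h.gram, smul_smul, inv_mul_cancel₀ hn, one_smul]
  rw [← isUnit_transpose]
  exact IsUnit.of_mul_eq_one _ h1

lemma IsTypeII.transpose (h : IsTypeII M) : IsTypeII Mᵀ := by
  refine ⟨h.schur.transpose, ?_⟩
  have := congrArg Matrix.transpose h.schurInv_mul_transpose
  rwa [transpose_mul, transpose_smul, transpose_one] at this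

lemma diagonal_mul_diagonal_schurInv (h : IsSchurInvertible M) (k : ι) :
    diagonal (M k) * diagonal (schurInv M k) = 1 := by
  rw [diagonal_mul_diagonal, ← diagonal_one]
  congr 1
  funext i
  exact mul_inv_cancel₀ (h k i)

lemma diagonal_schurInv_mul_diagonal (h : IsSchurInvertible M) (k : ι) :
    diagonal (schurInv M k) * diagonal (M k) = 1 :=
  mul_eq_one_comm.1 (diagonal_mul_diagonal_schurInv h k)

/-- The duality between the Nomura algebras of a type-II matrix and of its transpose. -/
lemma IsTypeII.dual (hM : IsTypeII M) {F S : Matrix ι ι ℂ}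
    (h : IsEigen M (schurInv M) F S) :
    IsEigen Mᵀ (schurInv Mᵀ) S ((Fintype.card ι : ℂ) • Fᵀ) := by
  rw [isEigen_iff_col]
  rw [isEigen_iff_row] at h
  intro k
  have h1 := congrArg Matrix.transpose (h k)
  simp only [transpose_mul, transpose_transpose, diagonal_transpose] at h1
  -- These factors turn the row form for `M` into the column form for `Mᵀ`, at the cost of the
  -- factor `card ι`.
  have h2 := congrArg (fun X => diagonal (schurInv M k) * X * Mᵀ) h1
  simp only [Matrix.mul_assoc, hM.schurInv_mul_transpose] at h2
  rw [← Matrix.mul_assoc (diagonal (schurInv M k)) (diagonal (M k)),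
    diagonal_schurInv_mul_diagonal hM.schur, Matrix.one_mul] at h2
  have h3 : diagonal (fun l => ((Fintype.card ι : ℂ) • Fᵀ) l k) =
      (Fintype.card ι : ℂ) • diagonal (F k) := by
    rw [← diagonal_smul]; rfl
  rw [h3]
  simp only [Matrix.mul_smul, Matrix.mul_one, Matrix.mul_assoc] at h2 ⊢
  exact h2.symm

/-- Duality applied twice returns `F` and `S` transposed, both scaled by `card ι`. -/
lemma IsTypeII.isEigen_transpose (hM : IsTypeII M) {F S : Matrix ι ι ℂ}
    (h : IsEigen M (schurInv M) F S) : IsEigen M (schurInv M) Fᵀ Sᵀ := by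
  rcases isEmpty_or_nonempty ι with _ | _
  · exact fun k => isEmptyElim k
  have hn : (Fintype.card ι : ℂ) ≠ 0 := Nat.cast_ne_zero.2 Fintype.card_ne_zero
  exact (hM.transpose.dual (hM.dual h)).of_smul hn

lemma IsTypeII.transpose_mem_nomura (hM : IsTypeII M) {F : Matrix ι ι ℂ} (h : F ∈ nomura M) :
    Fᵀ ∈ nomura M := by
  obtain ⟨S, hS⟩ := mem_nomura_iff.1 h
  exact mem_nomura_iff.2 ⟨_, hM.isEigen_transpose hS⟩

lemma IsTypeII.mem_nomura_of_isEigen (hM : IsTypeII M) {F S : Matrix ι ι ℂ}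
    (h : IsEigen Mᵀ (schurInv Mᵀ) F S) : S ∈ nomura M := by
  exact mem_nomura_iff.2 ⟨_, hM.transpose.dual h⟩

/-- Duality turns ordinary products into Schur products: the duals of `F` and `G` multiply in
`N_{Mᵀ}`, and the eigenvalue matrix of their product lies in `N_M`. -/
lemma IsTypeII.hadamard_mem_nomura (hM : IsTypeII M) {F G : Matrix ι ι ℂ} (hF : F ∈ nomura M)
    (hG : G ∈ nomura M) : F ⊙ G ∈ nomura M := by
  rcases isEmpty_or_nonempty ι with _ | _
  · rw [Subsingleton.elim (F ⊙ G) 1]; exact one_mem _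
  have hn : (Fintype.card ι : ℂ) ≠ 0 := Nat.cast_ne_zero.2 Fintype.card_ne_zero
  obtain ⟨S, hS⟩ := mem_nomura_iff.1 hF
  obtain ⟨T, hT⟩ := mem_nomura_iff.1 hG
  have h := hM.transpose_mem_nomura (hM.mem_nomura_of_isEigen ((hM.dual hS).mul (hM.dual hT)))
  have h2 : F ⊙ G = ((Fintype.card ι : ℂ)⁻¹ * (Fintype.card ι : ℂ)⁻¹) •
      (((Fintype.card ι : ℂ) • Fᵀ) ⊙ ((Fintype.card ι : ℂ) • Gᵀ))ᵀ := by
    ext i j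
    simp only [hadamard_apply, Matrix.smul_apply, transpose_apply, smul_eq_mul]
    field_simp
  rw [h2]
  exact Subalgebra.smul_mem _ h _

/-- `F * G` and `G * F` have the same eigenvalues on vectors that span. -/
lemma IsTypeII.nomura_comm (hM : IsTypeII M) {F G : Matrix ι ι ℂ} (hF : F ∈ nomura M)
    (hG : G ∈ nomura M) : F * G = G * F := by
  obtain ⟨S, hS⟩ := mem_nomura_iff.1 hF
  obtain ⟨T, hT⟩ := mem_nomura_iff.1 hG
  have h := hT.mul hS
  rw [hadamard_comm] at h
  exact (hS.mul hT).left_injective hM.isUnit (isSchurInvertible_schurInv hM.schur) h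

/-- The vector is all-ones for `l = j`, and for `l ≠ j` its entries sum to zero by the type-II
condition. -/
lemma IsTypeII.allOnes_mem_nomura (hM : IsTypeII M) :
    (Matrix.of fun _ _ => (1 : ℂ)) ∈ nomura M := by
  refine mem_nomura_iff.2 ⟨(Fintype.card ι : ℂ) • (1 : Matrix ι ι ℂ), fun k l j => ?_⟩
  have h := congrFun (congrFun hM.gram l) j
  rw [mul_apply] at h
  simp only [of_apply, one_mul]
  refine Eq.trans h ?_
  by_cases hlj : l = j
  · subst hlj
    have : M k l * schurInv M k l = 1 := mul_inv_cancel₀ (hM.schur k l)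
    rw [this, mul_one]
  · simp [one_apply_ne hlj]

/-- The Nomura algebra of a type-II matrix is the Bose–Mesner algebra of an association scheme. -/
theorem IsTypeII.isSchemeOf_nomura [Nonempty ι] (hM : IsTypeII M) :
    IsSchemeOf (schurIdempotents (nomura M : Set (Matrix ι ι ℂ))) (nomura M) :=
  isSchemeOf_schurIdempotents _ hM.allOnes_mem_nomura
    (fun _ hF _ hG => hM.hadamard_mem_nomura hF hG) (fun _ hF => hM.transpose_mem_nomura hF)
    (fun _ hF _ hG => hM.nomura_comm hF hG)

/-- Eigenvectors of the transpose, through the dual basis. -/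
lemma IsTypeII.isEigen_schurInv {A B F S : Matrix ι ι ℂ} (hA : IsTypeII A)
    (hB : IsSchurInvertible B) (h : IsEigen A B F S) :
    IsEigen (schurInv A) (schurInv B) Fᵀ S := by
  rw [isEigen_iff_col] at *
  intro j
  have h1 := congrArg Matrix.transpose (h j)
  simp only [transpose_mul, diagonal_transpose] at h1
  have e1 : diagonal (fun m => B m j) * diagonal (fun m => schurInv B m j) = 1 :=
    diagonal_mul_diagonal_schurInv hB.transpose j
  have e2 : diagonal (fun m => schurInv B m j) * diagonal (fun m => B m j) = 1 :=
    mul_eq_one_comm.1 e1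
  rcases isEmpty_or_nonempty ι with _ | _
  · exact Subsingleton.elim _ _
  have hn : (Fintype.card ι : ℂ) ≠ 0 := Nat.cast_ne_zero.2 Fintype.card_ne_zero
  have h2 := congrArg (fun X => diagonal (fun m => schurInv B m j) * schurInv A * X *
    (diagonal (fun m => schurInv B m j) * schurInv A)) h1
  simp only [Matrix.mul_assoc] at h2
  rw [← Matrix.mul_assoc (diagonal fun m => B m j) (diagonal fun m => schurInv B m j), e1,
    Matrix.one_mul, hA.gram, ← Matrix.mul_assoc (schurInv A) Aᵀ,
    hA.schurInv_mul_transpose] at h2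
  simp only [Matrix.mul_smul, Matrix.smul_mul, Matrix.one_mul, Matrix.mul_one] at h2
  rw [← Matrix.mul_assoc (diagonal fun m => schurInv B m j) (diagonal fun m => B m j), e2,
    Matrix.one_mul] at h2
  simpa only [Matrix.mul_assoc] using smul_right_injective _ hn h2

end TypeII

end JonesPair

namespace JonesPair

open Matrix

/-! ### Jones pairs: type-II property, exchange and extension -/

section Pairs

variable {ι : Type*} [Fintype ι] [DecidableEq ι] {A B : Matrix ι ι ℂ}

lemma hadamard_hadamard_schurInv (hA : IsSchurInvertible A) (G : Matrix ι ι ℂ) :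
    A ⊙ (G ⊙ schurInv A) = G := by
  ext i j
  have := hA i j
  simp only [hadamard_apply, schurInv, of_apply]
  field_simp

lemma IsOneSidedJonesPair.isUnit (h : IsOneSidedJonesPair A B) : IsUnit A := by
  obtain ⟨M, hM⟩ := ((Module.End.isUnit_iff _).1 h.isUnit_opX).2 1
  exact IsUnit.of_mul_eq_one M hM

lemma IsOneSidedJonesPair.isSchurInvertible (h : IsOneSidedJonesPair A B) :
    IsSchurInvertible B := by
  obtain ⟨M, hM⟩ := ((Module.End.isUnit_iff _).1 h.isUnit_opDelta).2 (Matrix.of fun _ _ => 1)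
  intro i j h0
  have : B i j * M i j = 1 := congrFun (congrFun hM i) j
  rw [h0, zero_mul] at this
  exact zero_ne_one this

/-- The braid relation says that `A` has the eigenvectors `A e_l ∘ B e_j`, with eigenvalue
`B l j`. -/
lemma IsOneSidedJonesPair.isEigen (h : IsOneSidedJonesPair A B) : IsEigen A B A B := by
  intro k l j
  -- On the matrix unit `E_lj` only column `j` survives, and there `A * E_lj` is `A e_l`.
  have h1 : A * (B ⊙ (A * single l j 1)) = B ⊙ (A * (B ⊙ single l j 1)) :=
    LinearMap.congr_fun h.braid (single l j 1)
  have h2 := congrFun (congrFun h1 k) j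
  have e1 : ∀ m, (A * single l j (1 : ℂ)) m j = A m l := by simp
  have e2 : ∀ m, (B ⊙ single l j (1 : ℂ)) m j = if m = l then B l j else 0 := by
    intro m
    by_cases hm : m = l
    · subst hm; simp
    · simp [hm, Ne.symm hm]
  rw [mul_apply, hadamard_apply, mul_apply] at h2
  simp only [hadamard_apply, e1] at h2
  simp only [← hadamard_apply, e2] at h2
  simp only [mul_ite, mul_zero, Finset.sum_ite_eq', Finset.mem_univ, if_true] at h2
  rw [show B l j * (A k l * B k j) = B k j * (A k l * B l j) by ring, ← h2]
  exact Finset.sum_congr rfl fun m _ => by ring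

/-- If the order of `M` times each product `M i j * M⁻¹ j i` is one, then `M` is type II. -/
lemma isTypeII_of_mul_inv {M : Matrix ι ι ℂ} (hM : IsUnit M)
    (h : ∀ i j, (Fintype.card ι : ℂ) * (M i j * M⁻¹ j i) = 1) : IsTypeII M := by
  have hs : IsSchurInvertible M := fun i j h0 => by
    have := h i j
    rw [h0, zero_mul, mul_zero] at this
    exact zero_ne_one this
  refine ⟨hs, ?_⟩
  have : schurInv M = (Fintype.card ι : ℂ) • (M⁻¹)ᵀ := by
    ext i j
    rw [Matrix.smul_apply, transpose_apply, smul_eq_mul]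
    refine inv_eq_of_mul_eq_one_right ?_
    rw [← h i j]
    ring
  rw [this, Matrix.mul_smul, ← transpose_mul, nonsing_inv_mul _ ((isUnit_iff_isUnit_det _).1 hM),
    transpose_one]

/-- With `D = diag (B e_j)` the eigenvector relation reads `A D A = D A D`; compare diagonal entries
of `A D = D A D A⁻¹` and cancel `B l j`. -/
lemma sum_mul_inv_eq_diag (hA : IsUnit A) (hB : IsSchurInvertible B) (h : IsEigen A B A B)
    (l j : ι) : ∑ m, B m j * (A l m * A⁻¹ m l) = A l l := by
  have hdet := (isUnit_iff_isUnit_det _).1 hA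
  have h1 := congrArg (fun X => X * A⁻¹) (isEigen_iff_col.1 h j)
  simp only at h1
  rw [Matrix.mul_assoc _ A, mul_nonsing_inv _ hdet, Matrix.mul_one] at h1
  have h2 := congrFun (congrFun h1 l) l
  rw [mul_diagonal, Matrix.mul_assoc, Matrix.mul_assoc, diagonal_mul, ← Matrix.mul_assoc,
    mul_apply] at h2
  simp only [mul_diagonal] at h2
  apply mul_left_cancel₀ (hB l j)
  rw [mul_comm (B l j) (A l l), h2]
  congr 1
  exact Finset.sum_congr rfl fun m _ => by ring

/-- Both matrices of an invertible Jones pair are type II. -/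
theorem IsInvertibleJonesPair.isTypeII [Nonempty ι] (h : IsInvertibleJonesPair A B) :
    IsTypeII A ∧ IsTypeII B := by
  have hA := h.isJonesPair.left.isUnit
  have hE := h.isJonesPair.left.isEigen
  have hBdet := (isUnit_iff_isUnit_det _).1 h.isUnit
  have hAdet := (isUnit_iff_isUnit_det _).1 hA
  have hU : ∀ l j, ∑ m, B j m * (A l m * A⁻¹ m l) = A l l :=
    sum_mul_inv_eq_diag hA h.isJonesPair.right.isSchurInvertible h.isJonesPair.right.isEigen
  -- Sum `hU` over `l`: the numbers `A l m * A⁻¹ m l` sum to 1 over `l`.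
  have hrow : ∀ j, ∑ m, B j m = A.trace := by
    intro j
    have htrace : A.trace = ∑ l, ∑ m, B j m * (A l m * A⁻¹ m l) :=
      Finset.sum_congr rfl fun l _ => (hU l j).symm
    rw [htrace, Finset.sum_comm]
    refine Finset.sum_congr rfl fun m _ => ?_
    rw [← Finset.mul_sum]
    have : ∑ l, A l m * A⁻¹ m l = 1 := by
      have := congrFun (congrFun (nonsing_inv_mul _ hAdet) m) m
      rw [mul_apply, one_apply_eq] at this
      rw [← this]
      exact Finset.sum_congr rfl fun l _ => mul_comm _ _
    rw [this, mul_one]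
  -- solutions of `B v = c 1` are the constant vectors
  have hsolve : ∀ (v : ι → ℂ) (c : ℂ), (∀ j, ∑ m, B j m * v m = c) →
      ∀ m, A.trace * v m = c := by
    intro v c hv m
    have h0 : B *ᵥ (A.trace • v - fun _ => c) = B *ᵥ 0 := by
      funext j
      rw [mulVec_zero, mulVec_sub, mulVec_smul]
      have h1 : (B *ᵥ v) j = c := hv j
      have h2 : (B *ᵥ fun _ => c) j = A.trace * c := by
        rw [← hrow j, Finset.sum_mul]
        rfl
      rw [Pi.sub_apply, Pi.smul_apply, h1, h2, smul_eq_mul, sub_self, Pi.zero_apply]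
    have h1 := mulVec_injective_of_isUnit h.isUnit h0
    exact sub_eq_zero.1 (congrFun h1 m)
  have htr : A.trace ≠ 0 := by
    intro h0
    have h1 : B *ᵥ (fun _ => (1 : ℂ)) = B *ᵥ 0 := by
      funext j
      rw [mulVec_zero, Pi.zero_apply, ← h0, ← hrow j]
      simp [mulVec, dotProduct]
    obtain ⟨i⟩ := ‹Nonempty ι›
    exact one_ne_zero (congrFun (mulVec_injective_of_isUnit h.isUnit h1) i)
  have hUt : ∀ l m, A.trace * (A l m * A⁻¹ m l) = A l l := fun l =>
    hsolve (fun m => A l m * A⁻¹ m l) _ (hU l)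
  -- By `hUt` the product `A l m * A⁻¹ m l` does not depend on `m`, and it sums to 1 over `m`.
  have hdiag : ∀ l, (Fintype.card ι : ℂ) * A l l = A.trace := by
    intro l
    have h1 : ∑ m, A.trace * (A l m * A⁻¹ m l) = (Fintype.card ι : ℂ) * A l l := by
      rw [Finset.sum_congr rfl fun m _ => hUt l m]
      simp
    have h2 := congrFun (congrFun (mul_nonsing_inv _ hAdet) l) l
    rw [mul_apply, one_apply_eq] at h2
    rw [← h1, ← Finset.mul_sum, h2, mul_one]
  refine ⟨isTypeII_of_mul_inv hA fun l m => ?_, isTypeII_of_mul_inv h.isUnit fun l j => ?_⟩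
  · apply mul_left_cancel₀ htr
    rw [mul_left_comm, hUt, hdiag, mul_one]
  -- The analogue of `hU` for `B`, from the row form; cancelling `A k l` needs `A` Schur-invertible.
  · have hV : ∀ k, ∑ j, B k j * (B l j * B⁻¹ j l) = A l l := by
      intro k
      have h1 := congrArg (fun X => Xᵀ * B⁻¹) (isEigen_iff_row.1 hE k)
      simp only [transpose_mul, transpose_transpose, diagonal_transpose] at h1
      rw [← Matrix.mul_assoc, Matrix.mul_assoc _ B, mul_nonsing_inv _ hBdet, Matrix.mul_one] at h1
      have h2 := congrFun (congrFun h1 l) l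
      rw [mul_diagonal, Matrix.mul_assoc, diagonal_mul, mul_apply] at h2
      simp only [mul_diagonal, transpose_apply] at h2
      apply mul_left_cancel₀ (h.isSchurInvertible k l)
      rw [mul_comm _ (A l l), h2]
      congr 1
      exact Finset.sum_congr rfl fun m _ => by ring
    apply mul_left_cancel₀ htr
    rw [mul_left_comm, hsolve (fun j => B l j * B⁻¹ j l) _ hV j, hdiag, mul_one]

/-- Exchange: the matrices with eigenvectors `A e_l ∘ B e_j` are, once one of them is known,
described by the Nomura algebra of `Bᵀ`. -/
lemma isEigen_hadamard_iff {N T : Matrix ι ι ℂ} (hA : IsUnit A) (hB : IsSchurInvertible B)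
    (hN : IsSchurInvertible N) (h : IsEigen A B N T) (K P : Matrix ι ι ℂ) :
    IsEigen A B (N ⊙ K) (T * Pᵀ) ↔ IsEigen Bᵀ (schurInv Bᵀ) P Kᵀ := by
  rw [isEigen_iff_row] at h
  rw [isEigen_iff_row, isEigen_iff_col]
  refine forall_congr' fun k => ?_
  have e1 : diagonal ((N ⊙ K) k) = diagonal (K k) * diagonal (N k) := by
    rw [diagonal_mul_diagonal]
    congr 1
    funext i
    exact mul_comm _ _
  -- The known solution eliminates `T`, so both sides of the row form end in `diagonal (N k) * A`;
  -- cancelling this leaves a column form for `Bᵀ`.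
  have e2 : Tᵀ * diagonal (A k) = diagonal (schurInv B k) * (Bᵀ * diagonal (N k) * A) := by
    rw [h k, ← Matrix.mul_assoc, ← Matrix.mul_assoc, diagonal_schurInv_mul_diagonal hB,
      Matrix.one_mul]
  have e3 : diagonal (B k) * (T * Pᵀ)ᵀ * diagonal (A k) =
      diagonal (B k) * (P * diagonal (schurInv B k) * Bᵀ) * diagonal (N k) * A := by
    rw [transpose_mul, transpose_transpose]
    simp only [Matrix.mul_assoc] at e2 ⊢
    rw [e2]
  have e4 : Bᵀ * diagonal ((N ⊙ K) k) * A =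
      diagonal (B k) * (diagonal (schurInv B k) * Bᵀ * diagonal (K k)) * diagonal (N k) * A := by
    rw [e1]
    simp only [← Matrix.mul_assoc]
    rw [diagonal_mul_diagonal_schurInv hB, Matrix.one_mul]
  rw [e3, e4, hA.mul_left_inj, (isUnit_diagonal_of_ne_zero (hN k)).mul_left_inj,
    (isUnit_diagonal_of_ne_zero (hB k)).mul_right_inj]
  exact eq_comm

lemma IsEigen.inv {M N S : Matrix ι ι ℂ} (h : IsEigen A B M S) (hMN : M * N = 1)
    (hS : IsSchurInvertible S) : IsEigen A B N (schurInv S) := by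
  rw [isEigen_iff_col] at *
  intro j
  have e1 : diagonal (fun l => S l j) * diagonal (fun l => schurInv S l j) = 1 :=
    diagonal_mul_diagonal_schurInv hS.transpose j
  have h1 := congrArg (fun X => N * X * diagonal (fun l => schurInv S l j)) (h j)
  simp only [Matrix.mul_assoc] at h1
  rw [e1, Matrix.mul_one, ← Matrix.mul_assoc N M, mul_eq_one_comm.1 hMN, Matrix.one_mul] at h1
  rw [Matrix.mul_assoc, ← h1, Matrix.mul_assoc]

/-- The properties of an invertible Jones pair with symmetric first matrix that determine the
Nomura algebras. -/
structure IsSymmPair (A B : Matrix ι ι ℂ) : Prop where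
  symm : Aᵀ = A
  left : IsTypeII A
  right : IsTypeII B
  eigen : IsEigen A B A B
  eigen_transpose : IsEigen A Bᵀ A Bᵀ

namespace IsSymmPair

variable (p : IsSymmPair A B)
include p

lemma transpose : IsSymmPair A Bᵀ :=
  ⟨p.symm, p.left, p.right.transpose, p.eigen_transpose, p.eigen⟩

lemma isEigen_hadamard_mul_right (K P : Matrix ι ι ℂ) :
    IsEigen A B (A ⊙ K) (B * Pᵀ) ↔ IsEigen Bᵀ (schurInv Bᵀ) P Kᵀ :=
  isEigen_hadamard_iff p.left.isUnit p.right.schur p.left.schur p.eigen K P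

/-- The vectors are symmetric in `A` and `B`, so exchange also applies with the roles swapped; `Aᵀ =
A` turns `N_{Aᵀ}` into `N_A`. -/
lemma isEigen_hadamard_mul_left (K P : Matrix ι ι ℂ) :
    IsEigen A B (A ⊙ K) (P * B) ↔ IsEigen A (schurInv A) P Kᵀ := by
  have h := isEigen_hadamard_iff p.right.isUnit p.left.schur p.left.schur p.eigen.swap K P
  rw [p.symm] at h
  rw [← h, ← transpose_mul]
  exact ⟨IsEigen.swap, IsEigen.swap⟩

/-- Both sides describe the same solution `A ∘ Kᵀ`, its eigenvalue matrix being factored in two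
ways. -/
lemma isEigen_intertwine {P Q K : Matrix ι ι ℂ} (h : P * B = B * Qᵀ) :
    IsEigen A (schurInv A) P K ↔ IsEigen Bᵀ (schurInv Bᵀ) Q K := by
  have h1 := p.isEigen_hadamard_mul_left Kᵀ P
  rw [h, p.isEigen_hadamard_mul_right, transpose_transpose] at h1
  exact h1.symm

lemma mul_inv : B * B⁻¹ = 1 :=
  mul_nonsing_inv _ ((isUnit_iff_isUnit_det _).1 p.right.isUnit)

lemma inv_mul : B⁻¹ * B = 1 :=
  nonsing_inv_mul _ ((isUnit_iff_isUnit_det _).1 p.right.isUnit)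

/-- Dualise `F` in `N_A`, transport the dual to `N_{Bᵀ}` with its eigenvalues kept, and dualise
back. -/
lemma nomura_left_le : nomura A ≤ nomura B := by
  rcases isEmpty_or_nonempty ι with _ | _
  · intro F _
    rw [Subsingleton.elim F 1]; exact one_mem _
  have hn : (Fintype.card ι : ℂ) ≠ 0 := Nat.cast_ne_zero.2 Fintype.card_ne_zero
  intro F hF
  obtain ⟨K, hK⟩ := mem_nomura_iff.1 hF
  have h1 := p.left.dual hK
  rw [p.symm] at h1
  have h2 := (p.isEigen_intertwine (Q := (B⁻¹ * K * B)ᵀ)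
    (by rw [transpose_transpose, ← Matrix.mul_assoc, ← Matrix.mul_assoc, p.mul_inv,
      Matrix.one_mul])).1 h1
  have h3 := p.right.transpose_mem_nomura (p.right.mem_nomura_of_isEigen h2)
  have h4 := Subalgebra.smul_mem _ h3 (Fintype.card ι : ℂ)⁻¹
  rwa [transpose_smul, transpose_transpose, smul_smul, inv_mul_cancel₀ hn, one_smul] at h4

lemma nomura_right_le : nomura B ≤ nomura A := by
  rcases isEmpty_or_nonempty ι with _ | _
  · intro F _
    rw [Subsingleton.elim F 1]; exact one_mem _
  have hn : (Fintype.card ι : ℂ) ≠ 0 := Nat.cast_ne_zero.2 Fintype.card_ne_zero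
  intro F hF
  obtain ⟨K, hK⟩ := mem_nomura_iff.1 hF
  have h1 := p.right.dual hK
  have h2 := (p.isEigen_intertwine (P := B * Kᵀ * B⁻¹)
    (by rw [Matrix.mul_assoc, p.inv_mul, Matrix.mul_one])).2 h1
  have h3 := p.left.mem_nomura_of_isEigen (by rwa [p.symm])
  have h4 := p.left.transpose_mem_nomura (Subalgebra.smul_mem _ h3 (Fintype.card ι : ℂ)⁻¹)
  rwa [smul_smul, inv_mul_cancel₀ hn, one_smul, transpose_transpose] at h4

/-- `A⁻¹` is a solution with eigenvalue matrix `B⁽⁻⁾`, so exchange puts `B⁽⁻⁾ * B⁻¹` in the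
commutative algebra `N_A`; by type II this is a multiple of `(B * Bᵀ)⁻¹`. -/
lemma commute_mul_transpose {Q : Matrix ι ι ℂ} (hQ : Q ∈ nomura A) :
    Q * (B * Bᵀ) = B * Bᵀ * Q := by
  rcases isEmpty_or_nonempty ι with _ | _
  · exact Subsingleton.elim _ _
  have hn : (Fintype.card ι : ℂ) ≠ 0 := Nat.cast_ne_zero.2 Fintype.card_ne_zero
  have hP : schurInv B * B⁻¹ ∈ nomura A := by
    have h1 := p.eigen.inv (mul_nonsing_inv _ ((isUnit_iff_isUnit_det _).1 p.left.isUnit))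
      p.right.schur
    rw [← hadamard_hadamard_schurInv p.left.schur A⁻¹,
      show schurInv B = schurInv B * B⁻¹ * B by
        rw [Matrix.mul_assoc, p.inv_mul, Matrix.mul_one],
      p.isEigen_hadamard_mul_left] at h1
    exact mem_nomura_iff.2 ⟨_, h1⟩
  have hX : ((Fintype.card ι : ℂ)⁻¹ • (schurInv B * B⁻¹)) * (B * Bᵀ) = 1 := by
    rw [Matrix.smul_mul, Matrix.mul_assoc, ← Matrix.mul_assoc B⁻¹, p.inv_mul, Matrix.one_mul,
      p.right.schurInv_mul_transpose, smul_smul, inv_mul_cancel₀ hn, one_smul]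
  have hc := p.left.nomura_comm hQ (Subalgebra.smul_mem _ hP (Fintype.card ι : ℂ)⁻¹)
  generalize (Fintype.card ι : ℂ)⁻¹ • (schurInv B * B⁻¹) = P at hX hc
  generalize B * Bᵀ = X at hX
  have hX' := mul_eq_one_comm.1 hX
  calc Q * X = X * P * (Q * X) := by rw [hX', Matrix.one_mul]
    _ = X * (P * Q) * X := by simp only [Matrix.mul_assoc]
    _ = X * (Q * P) * X := by rw [hc]
    _ = X * Q := by rw [Matrix.mul_assoc, Matrix.mul_assoc, hX, Matrix.mul_one]

/-- The symmetric part of the extension from `N_{Wᵀ}` to `N_V`. -/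
lemma exists_extension_symm {F K : Matrix ι ι ℂ} (h : IsEigen A (schurInv A) F K) :
    ∃ F' K', IsEigen B (schurInv B) F K' ∧ IsEigen Bᵀ (schurInv Bᵀ) F' Kᵀ ∧
      IsEigen A (schurInv A) F' K'ᵀ := by
  obtain ⟨K', hK'⟩ := mem_nomura_iff.1 (p.nomura_left_le (mem_nomura_iff.2 ⟨K, h⟩))
  have e : B * (B⁻¹ * F * B) = F * B := by
    rw [← Matrix.mul_assoc, ← Matrix.mul_assoc, p.mul_inv, Matrix.one_mul]
  refine ⟨B⁻¹ * F * B, K', hK', ?_, ?_⟩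
  · have h1 := (p.isEigen_intertwine (Q := (B⁻¹ * F * B)ᵀ)
      (by rw [transpose_transpose, e])).1 h
    simpa using p.right.transpose.isEigen_transpose h1
  · have h1 := (p.transpose.isEigen_intertwine (P := (B⁻¹ * F * B)ᵀ) (Q := F) (K := K')
      (by rw [← transpose_mul, e, transpose_mul])).2 hK'
    simpa using p.left.isEigen_transpose h1

/-- The skew part of the extension from `N_{Wᵀ}` to `N_V`. -/
lemma exists_extension_skew {G S : Matrix ι ι ℂ} (h : IsEigen A B G S) :
    ∃ G' S', IsEigen (schurInv A) (schurInv B) G S' ∧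
      IsEigen (schurInv A) (schurInv Bᵀ) G' Sᵀ ∧ IsEigen A Bᵀ G' S'ᵀ := by
  have hsymm : ∀ L : Matrix ι ι ℂ, (A ⊙ L)ᵀ = A ⊙ Lᵀ := fun L => by
    rw [transpose_hadamard, p.symm]
  obtain ⟨L, rfl⟩ : ∃ L, G = A ⊙ L := ⟨_, (hadamard_hadamard_schurInv p.left.schur G).symm⟩
  obtain ⟨Q, rfl⟩ : ∃ Q, S = Q * B :=
    ⟨S * B⁻¹, by rw [Matrix.mul_assoc, p.inv_mul, Matrix.mul_one]⟩
  obtain ⟨R, hR⟩ : ∃ R, Q * B = B * Rᵀ :=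
    ⟨(B⁻¹ * (Q * B))ᵀ, by
      rw [transpose_transpose, ← Matrix.mul_assoc, p.mul_inv, Matrix.one_mul]⟩
  have hQ := (p.isEigen_hadamard_mul_left L Q).1 h
  obtain ⟨L', hL'⟩ := mem_nomura_iff.1 (p.transpose.nomura_right_le
    (mem_nomura_iff.2 ⟨_, (p.isEigen_intertwine hR).1 hQ⟩))
  -- `L'` holds the eigenvalues on `A` of the `R ∈ N_{Bᵀ}` corresponding to `Q`.
  refine ⟨A ⊙ L', Qᵀ * B, ?_, ?_, ?_⟩
  · have h1 := (p.isEigen_hadamard_mul_left Lᵀ Qᵀ).2 (p.left.isEigen_transpose hQ)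
    have h2 := p.left.isEigen_schurInv p.right.schur h1
    rwa [hsymm, transpose_transpose] at h2
  · have h1 := (p.transpose.isEigen_hadamard_mul_left L'ᵀ R).2 (by rwa [transpose_transpose])
    have h2 := p.left.isEigen_schurInv p.right.schur.transpose h1
    rw [hsymm, transpose_transpose] at h2
    rwa [hR, transpose_mul, transpose_transpose]
  · have h1 := (p.transpose.isEigen_hadamard_mul_left L' Rᵀ).2 (p.left.isEigen_transpose hL')
    convert h1 using 1
    rw [transpose_mul, transpose_transpose]
    -- The claim is `Bᵀ * Q = Rᵀ * Bᵀ`; multiplied by `B` it says that `Q` commutes with `B * Bᵀ`.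
    refine p.right.isUnit.mul_right_injective ?_
    simp only
    rw [← Matrix.mul_assoc, ← Matrix.mul_assoc, ← hR,
      ← p.commute_mul_transpose (mem_nomura_iff.2 ⟨_, hQ⟩), Matrix.mul_assoc]

/-- Transposing `B` keeps the matrices with eigenvectors `A e_l ∘ B e_j`. -/
lemma isEigen_transpose_right {G S : Matrix ι ι ℂ} (h : IsEigen A B G S) :
    ∃ T, IsEigen A Bᵀ G T := by
  obtain ⟨L, rfl⟩ : ∃ L, G = A ⊙ L := ⟨_, (hadamard_hadamard_schurInv p.left.schur G).symm⟩
  obtain ⟨Q, rfl⟩ : ∃ Q, S = Q * B :=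
    ⟨S * B⁻¹, by rw [Matrix.mul_assoc, p.inv_mul, Matrix.mul_one]⟩
  -- The condition linking `L` and `Q` involves only `A`.
  exact ⟨_, (p.transpose.isEigen_hadamard_mul_left L Q).2
    ((p.isEigen_hadamard_mul_left L Q).1 h)⟩

end IsSymmPair

/-- An invertible Jones pair with symmetric first matrix. -/
lemma IsInvertibleJonesPair.isSymmPair [Nonempty ι] (h : IsInvertibleJonesPair A B)
    (hA : A.IsSymm) : IsSymmPair A B :=
  ⟨hA, h.isTypeII.1, h.isTypeII.2, h.isJonesPair.left.isEigen, h.isJonesPair.right.isEigen⟩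

end Pairs

end JonesPair

namespace JonesPair

open Matrix

/-! ### Nomura vectors of `V` and `Wᵀ`; the algebra `N_{Wᵀ}` -/

section Blocks

variable {ι : Type*}

/-- The sign of a row or column of a doubled index set. -/
def sgn : ι ⊕ ι → ℂ := Sum.elim (fun _ => 1) (fun _ => -1)

/-- The index below an element of a doubled index set. -/
def base : ι ⊕ ι → ι := Sum.elim id id

/-- The vector `(v, v)`. -/
def symmVec (v : ι → ℂ) : ι ⊕ ι → ℂ := fun x => v (base x)

/-- The vector `(v, -v)`. -/
def skewVec (v : ι → ℂ) : ι ⊕ ι → ℂ := fun x => sgn x * v (base x)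

/-- The matrix acting as `F` on the vectors `(v, v)` and as `G` on the vectors `(v, -v)`. -/
noncomputable def twist (F G : Matrix ι ι ℂ) : Matrix (ι ⊕ ι) (ι ⊕ ι) ℂ :=
  Matrix.of fun x y => (F (base x) (base y) + sgn x * sgn y * G (base x) (base y)) / 2

lemma sgn_mul_self (x : ι ⊕ ι) : sgn x * sgn x = 1 := by
  rcases x with x | x <;> simp [sgn]

lemma sgn_ne_zero (x : ι ⊕ ι) : sgn x ≠ 0 := by
  rcases x with x | x <;> simp [sgn]

lemma sgn_inv (x : ι ⊕ ι) : (sgn x)⁻¹ = sgn x := by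
  rcases x with x | x <;> simp [sgn]

lemma symmVec_smul (c : ℂ) (v : ι → ℂ) : symmVec (c • v) = c • symmVec v := rfl

lemma skewVec_smul (c : ℂ) (v : ι → ℂ) : skewVec (c • v) = c • skewVec v := by
  funext x
  simp only [skewVec, Pi.smul_apply, smul_eq_mul]
  ring

section Entries

variable (d : ℂ) (A B : Matrix ι ι ℂ) (x y : ι ⊕ ι)

lemma matV_inl_inl : matV d A B (.inl x) (.inl y) = sgn x * sgn y * (d * A (base x) (base y)) := by
  rcases x with x | x <;> rcases y with y | y <;> simp [matV, sgn, base]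

lemma matV_inr_inr : matV d A B (.inr x) (.inr y) = sgn x * sgn y * (d * A (base x) (base y)) := by
  rcases x with x | x <;> rcases y with y | y <;> simp [matV, sgn, base]

lemma matV_inl_inr : matV d A B (.inl x) (.inr y) = (B (base x) (base y))⁻¹ := by
  rcases x with x | x <;> rcases y with y | y <;> simp [matV, base, schurInv]

lemma matV_inr_inl : matV d A B (.inr x) (.inl y) = (B (base y) (base x))⁻¹ := by
  rcases x with x | x <;> rcases y with y | y <;> simp [matV, base, schurInv]

lemma matW_inl (i : ι) : (matW A B)ᵀ x (.inl i) = sgn x * A (base x) i := by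
  rcases x with x | x <;> simp [matW, sgn, base]

lemma matW_inr (i : ι) : (matW A B)ᵀ x (.inr i) = (B (base x) i)⁻¹ := by
  rcases x with x | x <;> simp [matW, base, schurInv]

variable {d}

lemma nomuraVec_matV_inl_inl (hd : d ≠ 0) : nomuraVec (matV d A B) (.inl x) (.inl y) =
    Sum.elim ((sgn x * sgn y) • symmVec (nomuraVec A (base x) (base y)))
      (symmVec (nomuraVec Bᵀ (base y) (base x))) := by
  funext k
  rcases k with k | k
  · simp only [nomuraVec, schurInv, of_apply, matV_inl_inl, Sum.elim_inl, symmVec, mul_inv, sgn_inv,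
      Pi.smul_apply, smul_eq_mul]
    linear_combination (sgn x * sgn y * d * d⁻¹ * A (base k) (base x) * (A (base k) (base y))⁻¹) *
      sgn_mul_self k + (sgn x * sgn y * A (base k) (base x) * (A (base k) (base y))⁻¹) *
      mul_inv_cancel₀ hd
  · simp only [nomuraVec, schurInv, of_apply, matV_inr_inl, Sum.elim_inr, symmVec, inv_inv,
      transpose_apply]
    ring

lemma nomuraVec_matV_inr_inr (hd : d ≠ 0) : nomuraVec (matV d A B) (.inr x) (.inr y) =
    Sum.elim (symmVec (nomuraVec B (base y) (base x)))
      ((sgn x * sgn y) • symmVec (nomuraVec A (base x) (base y))) := by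
  funext k
  rcases k with k | k
  · simp only [nomuraVec, schurInv, of_apply, matV_inl_inr, Sum.elim_inl, symmVec, inv_inv]
    ring
  · simp only [nomuraVec, schurInv, of_apply, matV_inr_inr, Sum.elim_inr, symmVec, mul_inv, sgn_inv,
      Pi.smul_apply, smul_eq_mul]
    linear_combination (sgn x * sgn y * d * d⁻¹ * A (base k) (base x) * (A (base k) (base y))⁻¹) *
      sgn_mul_self k + (sgn x * sgn y * A (base k) (base x) * (A (base k) (base y))⁻¹) *
      mul_inv_cancel₀ hd

lemma nomuraVec_matV_inl_inr : nomuraVec (matV d A B) (.inl x) (.inr y) =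
    Sum.elim ((sgn x * d) • skewVec (fun k => A k (base x) * B k (base y)))
      ((sgn y * d⁻¹) • skewVec (fun k => schurInv A k (base y) * schurInv Bᵀ k (base x))) := by
  funext k
  rcases k with k | k
  · simp only [nomuraVec, schurInv, of_apply, matV_inl_inl, matV_inl_inr, Sum.elim_inl, skewVec,
      inv_inv, Pi.smul_apply, smul_eq_mul]
    ring
  · simp only [nomuraVec, schurInv, of_apply, matV_inr_inl, matV_inr_inr, Sum.elim_inr, skewVec,
      mul_inv, sgn_inv, Pi.smul_apply, smul_eq_mul, transpose_apply]
    ring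

lemma nomuraVec_matV_inr_inl : nomuraVec (matV d A B) (.inr x) (.inl y) =
    Sum.elim ((sgn y * d⁻¹) • skewVec (fun k => schurInv A k (base y) * schurInv B k (base x)))
      ((sgn x * d) • skewVec (fun k => A k (base x) * Bᵀ k (base y))) := by
  funext k
  rcases k with k | k
  · simp only [nomuraVec, schurInv, of_apply, matV_inl_inl, matV_inl_inr, Sum.elim_inl, skewVec,
      mul_inv, sgn_inv, Pi.smul_apply, smul_eq_mul]
    ring
  · simp only [nomuraVec, schurInv, of_apply, matV_inr_inl, matV_inr_inr, Sum.elim_inr, skewVec,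
      inv_inv, Pi.smul_apply, smul_eq_mul, transpose_apply]
    ring

variable (i j : ι)

lemma nomuraVec_matW_inl_inl :
    nomuraVec (matW A B)ᵀ (.inl i) (.inl j) = symmVec (nomuraVec A i j) := by
  funext k
  simp only [nomuraVec, schurInv, of_apply, matW_inl, symmVec, mul_inv, sgn_inv]
  linear_combination (A (base k) i * (A (base k) j)⁻¹) * sgn_mul_self k

lemma nomuraVec_matW_inr_inr :
    nomuraVec (matW A B)ᵀ (.inr i) (.inr j) = symmVec (nomuraVec B j i) := by
  funext k
  simp only [nomuraVec, schurInv, of_apply, matW_inr, symmVec, inv_inv]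
  ring

lemma nomuraVec_matW_inl_inr :
    nomuraVec (matW A B)ᵀ (.inl i) (.inr j) = skewVec (fun k => A k i * B k j) := by
  funext k
  simp only [nomuraVec, schurInv, of_apply, matW_inl, matW_inr, skewVec, inv_inv]
  ring

lemma nomuraVec_matW_inr_inl :
    nomuraVec (matW A B)ᵀ (.inr i) (.inl j) =
      skewVec (fun k => schurInv A k j * schurInv B k i) := by
  funext k
  simp only [nomuraVec, schurInv, of_apply, matW_inl, matW_inr, skewVec, mul_inv, sgn_inv]
  ring

end Entries

variable [Fintype ι]

lemma sum_symmVec (v : ι → ℂ) : ∑ x, symmVec v x = 2 * ∑ i, v i := by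
  rw [Fintype.sum_sum_type, two_mul]
  rfl

lemma sum_skewVec (v : ι → ℂ) : ∑ x, skewVec v x = 0 := by
  simp [Fintype.sum_sum_type, skewVec, sgn, base]

lemma twist_mulVec_symmVec (F G : Matrix ι ι ℂ) (v : ι → ℂ) :
    twist F G *ᵥ symmVec v = symmVec (F *ᵥ v) := by
  funext x
  simp only [mulVec, dotProduct, Fintype.sum_sum_type, twist, symmVec, of_apply, sgn, base,
    Sum.elim_inl, Sum.elim_inr, id]
  rw [← Finset.sum_add_distrib]
  exact Finset.sum_congr rfl fun m _ => by ring

lemma twist_mulVec_skewVec (F G : Matrix ι ι ℂ) (v : ι → ℂ) :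
    twist F G *ᵥ skewVec v = skewVec (G *ᵥ v) := by
  funext x
  simp only [mulVec, dotProduct, Fintype.sum_sum_type, twist, skewVec, of_apply]
  rw [← Finset.sum_add_distrib, Finset.mul_sum]
  refine Finset.sum_congr rfl fun m _ => ?_
  simp only [sgn, base, Sum.elim_inl, Sum.elim_inr, id]
  ring

variable [DecidableEq ι]

lemma isTypeII_of_sum_nomuraVec {M : Matrix ι ι ℂ} (hM : IsSchurInvertible M)
    (h : ∀ i j, i ≠ j → ∑ k, nomuraVec M i j k = 0) : IsTypeII M := by
  refine ⟨hM, ?_⟩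
  ext i j
  rw [mul_apply]
  change ∑ k, nomuraVec M i j k = _
  by_cases hij : i = j
  · subst hij
    have : ∀ k, nomuraVec M i i k = 1 := fun k => mul_inv_cancel₀ (hM k i)
    simp [this]
  · simp [h i j hij, hij]

lemma IsTypeII.sum_nomuraVec {M : Matrix ι ι ℂ} (hM : IsTypeII M) (i j : ι) :
    ∑ k, nomuraVec M i j k = if i = j then (Fintype.card ι : ℂ) else 0 := by
  have h := congrFun (congrFun hM.gram i) j
  rw [mul_apply] at h
  refine Eq.trans h ?_
  rw [Matrix.smul_apply, one_apply, smul_eq_mul, mul_ite, mul_one, mul_zero]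

variable {A B : Matrix ι ι ℂ} {d : ℂ}

lemma isTypeII_matV (hA : IsTypeII A) (hB : IsTypeII B) (hd : d ≠ 0) :
    IsTypeII (matV d A B) := by
  refine isTypeII_of_sum_nomuraVec ?_ ?_
  · rintro (x | x) (y | y)
    · rw [matV_inl_inl]
      exact mul_ne_zero (mul_ne_zero (sgn_ne_zero _) (sgn_ne_zero _)) (mul_ne_zero hd (hA.schur _ _))
    · rw [matV_inl_inr]
      exact inv_ne_zero (hB.schur _ _)
    · rw [matV_inr_inl]
      exact inv_ne_zero (hB.schur _ _)
    · rw [matV_inr_inr]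
      exact mul_ne_zero (mul_ne_zero (sgn_ne_zero _) (sgn_ne_zero _)) (mul_ne_zero hd (hA.schur _ _))
  -- Distinct indices over one base have opposite signs, so the contributions of the two halves
  -- cancel.
  · have key : ∀ x y : ι ⊕ ι, x ≠ y → base x = base y → sgn x * sgn y = -1 := by
      rintro (x | x) (y | y) hxy h
      · exact absurd (congrArg Sum.inl h) hxy
      · simp [sgn]
      · simp [sgn]
      · exact absurd (congrArg Sum.inr h) hxy
    rintro (x | x) (y | y) hxy
    · rw [nomuraVec_matV_inl_inl A B x y hd, Fintype.sum_sum_type]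
      simp only [Sum.elim_inl, Sum.elim_inr, Pi.smul_apply, ← Finset.mul_sum, sum_symmVec,
        hA.sum_nomuraVec, hB.transpose.sum_nomuraVec, smul_eq_mul]
      by_cases hb : base x = base y
      · rw [key x y (fun h => hxy (congrArg Sum.inl h)) hb, if_pos hb, if_pos hb.symm]
        ring
      · rw [if_neg hb, if_neg (Ne.symm hb)]
        ring
    · rw [nomuraVec_matV_inl_inr, Fintype.sum_sum_type]
      simp only [Sum.elim_inl, Sum.elim_inr, Pi.smul_apply, smul_eq_mul, ← Finset.mul_sum, sum_skewVec]
      simp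
    · rw [nomuraVec_matV_inr_inl, Fintype.sum_sum_type]
      simp only [Sum.elim_inl, Sum.elim_inr, Pi.smul_apply, smul_eq_mul, ← Finset.mul_sum, sum_skewVec]
      simp
    · rw [nomuraVec_matV_inr_inr A B x y hd, Fintype.sum_sum_type]
      simp only [Sum.elim_inl, Sum.elim_inr, Pi.smul_apply, ← Finset.mul_sum, sum_symmVec,
        hA.sum_nomuraVec, hB.sum_nomuraVec, smul_eq_mul]
      by_cases hb : base x = base y
      · rw [key x y (fun h => hxy (congrArg Sum.inr h)) hb, if_pos hb, if_pos hb.symm]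
        ring
      · rw [if_neg hb, if_neg (Ne.symm hb)]
        ring

lemma isTypeII_matW_transpose (hA : IsTypeII A) (hB : IsTypeII B) : IsTypeII (matW A B)ᵀ := by
  refine isTypeII_of_sum_nomuraVec ?_ ?_
  · rintro x (y | y)
    · rw [matW_inl]
      exact mul_ne_zero (sgn_ne_zero _) (hA.schur _ _)
    · rw [matW_inr]
      exact inv_ne_zero (hB.schur _ _)
  · rintro (i | i) (j | j) hij
    · rw [nomuraVec_matW_inl_inl, sum_symmVec, hA.sum_nomuraVec,
        if_neg fun h => hij (congrArg Sum.inl h), mul_zero]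
    · rw [nomuraVec_matW_inl_inr, sum_skewVec]
    · rw [nomuraVec_matW_inr_inl, sum_skewVec]
    · rw [nomuraVec_matW_inr_inr, sum_symmVec, hB.sum_nomuraVec,
        if_neg fun h => hij (congrArg Sum.inr h.symm), mul_zero]

lemma IsEigen.mulVec_eq {M S : Matrix ι ι ℂ} (h : IsEigen A B M S) (l j : ι) :
    M *ᵥ (fun k => A k l * B k j) = S l j • fun k => A k l * B k j :=
  funext fun k => h k l j

lemma IsEigen.mulVec_nomuraVec {M S : Matrix ι ι ℂ} (h : IsEigen A (schurInv A) M S) (l j : ι) :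
    M *ᵥ nomuraVec A l j = S l j • nomuraVec A l j :=
  funext fun k => h k l j

/-- The Nomura algebra of `Wᵀ`. -/
lemma IsSymmPair.mem_nomura_matW_iff (p : IsSymmPair A B) {P : Matrix (ι ⊕ ι) (ι ⊕ ι) ℂ} :
    P ∈ nomura (matW A B)ᵀ ↔
      ∃ F G K S, IsEigen A (schurInv A) F K ∧ IsEigen A B G S ∧ P = twist F G := by
  constructor
  · intro h
    choose c hc using (h : ∀ i j, ∃ c : ℂ, P *ᵥ nomuraVec (matW A B)ᵀ i j =
      c • nomuraVec (matW A B)ᵀ i j)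
    have hs : ∀ x i j, ∑ m, P x (.inl m) * (A m i * schurInv A m j) +
        ∑ m, P x (.inr m) * (A m i * schurInv A m j) =
        c (.inl i) (.inl j) * (A (base x) i * schurInv A (base x) j) := by
      intro x i j
      have h1 := congrFun (hc (.inl i) (.inl j)) x
      rw [nomuraVec_matW_inl_inl] at h1
      simp only [mulVec, dotProduct, Fintype.sum_sum_type] at h1
      exact h1
    have ht : ∀ x i j, ∑ m, P x (.inl m) * (A m i * B m j) -
        ∑ m, P x (.inr m) * (A m i * B m j) =
        c (.inl i) (.inr j) * (sgn x * (A (base x) i * B (base x) j)) := by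
      intro x i j
      have h1 := congrFun (hc (.inl i) (.inr j)) x
      rw [nomuraVec_matW_inl_inr] at h1
      rw [sub_eq_add_neg, ← Finset.sum_neg_distrib]
      refine Eq.trans ?_ h1
      simp only [mulVec, dotProduct, Fintype.sum_sum_type, skewVec, sgn, base, Sum.elim_inl,
        Sum.elim_inr, one_mul, neg_mul, mul_neg, id]
    have hF₁ : IsEigen A (schurInv A) (P.toBlocks₁₁ + P.toBlocks₁₂)
        (of fun i j => c (.inl i) (.inl j)) := fun k l j => by
      refine Eq.trans ?_ (hs (.inl k) l j)
      simp only [Matrix.add_apply, add_mul, Finset.sum_add_distrib]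
      rfl
    have hF₂ : IsEigen A (schurInv A) (P.toBlocks₂₁ + P.toBlocks₂₂)
        (of fun i j => c (.inl i) (.inl j)) := fun k l j => by
      refine Eq.trans ?_ (hs (.inr k) l j)
      simp only [Matrix.add_apply, add_mul, Finset.sum_add_distrib]
      rfl
    have hG₁ : IsEigen A B (P.toBlocks₁₁ - P.toBlocks₁₂)
        (of fun i j => c (.inl i) (.inr j)) := fun k l j => by
      have h1 := ht (.inl k) l j
      simp only [sgn, base, Sum.elim_inl, id, one_mul] at h1
      refine Eq.trans ?_ h1
      simp only [Matrix.sub_apply, sub_mul, Finset.sum_sub_distrib]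
      rfl
    have hG₂ : IsEigen A B (P.toBlocks₂₂ - P.toBlocks₂₁)
        (of fun i j => c (.inl i) (.inr j)) := fun k l j => by
      have h1 := ht (.inr k) l j
      simp only [sgn, base, Sum.elim_inr, id] at h1
      have h2 : c (.inl l) (.inr j) * (A k l * B k j) =
          ∑ m, P (.inr k) (.inr m) * (A m l * B m j) -
          ∑ m, P (.inr k) (.inl m) * (A m l * B m j) := by linear_combination h1
      refine Eq.trans ?_ h2.symm
      simp only [Matrix.sub_apply, sub_mul, Finset.sum_sub_distrib]
      rfl
    -- Equal eigenvalues force equal block sums and equal block differences, which is the shape of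
    -- `twist`.
    have eF := hF₁.left_injective p.left.isUnit (isSchurInvertible_schurInv p.left.schur) hF₂
    have eG := hG₁.left_injective p.left.isUnit p.right.schur hG₂
    refine ⟨_, _, _, _, hF₁, hG₁, ?_⟩
    ext x y
    have e1 := congrFun (congrFun eF (base x)) (base y)
    have e2 := congrFun (congrFun eG (base x)) (base y)
    simp only [Matrix.add_apply, Matrix.sub_apply, toBlocks₁₁, toBlocks₁₂, toBlocks₂₁, toBlocks₂₂,
      of_apply] at e1 e2
    rcases x with x | x <;> rcases y with y | y <;>
      simp only [base, Sum.elim_inl, Sum.elim_inr, id] at e1 e2 <;>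
      simp only [twist, of_apply, Matrix.add_apply, Matrix.sub_apply, toBlocks₁₁, toBlocks₁₂,
        base, sgn, Sum.elim_inl, Sum.elim_inr, id]
    · ring
    · ring
    · linear_combination -(e1 - e2) / 2
    · linear_combination -(e1 + e2) / 2
  · rintro ⟨F, G, K, S, hF, hG, rfl⟩
    -- `hF` and `hG` cover two of the four families of Nomura vectors; the extension lemmas supply
    -- the other two.
    obtain ⟨-, K', hK', -, -⟩ := p.exists_extension_symm hF
    obtain ⟨-, S', hS', -, -⟩ := p.exists_extension_skew hG
    rintro (i | i) (j | j)
    · refine ⟨K i j, ?_⟩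
      rw [nomuraVec_matW_inl_inl, twist_mulVec_symmVec, hF.mulVec_nomuraVec, symmVec_smul]
    · refine ⟨S i j, ?_⟩
      rw [nomuraVec_matW_inl_inr, twist_mulVec_skewVec, hG.mulVec_eq, skewVec_smul]
    · refine ⟨S' j i, ?_⟩
      rw [nomuraVec_matW_inr_inl, twist_mulVec_skewVec, hS'.mulVec_eq, skewVec_smul]
    · refine ⟨K' j i, ?_⟩
      rw [nomuraVec_matW_inr_inr, twist_mulVec_symmVec, hK'.mulVec_nomuraVec, symmVec_smul]

/-- `B` enters the description of `N_{Wᵀ}` only through the skew part `G`, for which `B` may be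
transposed. -/
lemma IsSymmPair.nomura_matW_le_transpose (p : IsSymmPair A B) :
    nomura (matW A B)ᵀ ≤ nomura (matW A Bᵀ)ᵀ := by
  intro P hP
  obtain ⟨F, G, K, S, hF, hG, rfl⟩ := p.mem_nomura_matW_iff.1 hP
  obtain ⟨T, hT⟩ := p.isEigen_transpose_right hG
  exact p.transpose.mem_nomura_matW_iff.2 ⟨F, G, K, T, hF, hT, rfl⟩

lemma IsSymmPair.nomura_matW_transpose (p : IsSymmPair A B) :
    nomura (matW A Bᵀ)ᵀ = nomura (matW A B)ᵀ :=
  le_antisymm p.transpose.nomura_matW_le_transpose p.nomura_matW_le_transpose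

end Blocks

/-! ### Eigenvectors of block matrices -/

section Restriction

variable {κ : Type*} [Fintype κ] [DecidableEq κ]

lemma fromBlocks_mulVec_eq_smul {P Q : Matrix κ κ ℂ} {v w : κ → ℂ} {c : ℂ} (s t : ℂ)
    (hv : P *ᵥ v = c • v) (hw : Q *ᵥ w = c • w) :
    fromBlocks P 0 0 Q *ᵥ Sum.elim (s • v) (t • w) = c • Sum.elim (s • v) (t • w) := by
  rw [fromBlocks_mulVec]
  simp only [Sum.elim_comp_inl, Sum.elim_comp_inr, zero_mulVec, smul_zero, add_zero, zero_add, mulVec_smul,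
    hv, hw]
  funext x
  rcases x with x | x <;> simp only [Sum.elim_inl, Sum.elim_inr, Pi.smul_apply, smul_eq_mul] <;>
    ring

/-- If `(s v, w)` and `(-s v, w)` are eigenvectors, then `v` is an eigenvector of the first
diagonal block. -/
lemma exists_restrict_inl_mulVec {M : Matrix (κ ⊕ κ) (κ ⊕ κ) ℂ} {v w : κ → ℂ} {s : ℂ} (hs : s ≠ 0)
    {c c' : ℂ} (h : M *ᵥ Sum.elim (s • v) w = c • Sum.elim (s • v) w)
    (h' : M *ᵥ Sum.elim (-s • v) w = c' • Sum.elim (-s • v) w) :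
    ∃ b : ℂ, restrict Function.Embedding.inl M *ᵥ v = b • v := by
  -- Subtraction removes `w` and leaves twice the block applied to `s v`, equal to `(c + c') s v`.
  refine ⟨(c + c') / 2, funext fun x => ?_⟩
  have h1 := congrFun h (.inl x)
  have h2 := congrFun h' (.inl x)
  simp only [mulVec, dotProduct, Fintype.sum_sum_type, Sum.elim_inl, Sum.elim_inr, Pi.smul_apply,
    smul_eq_mul, mul_left_comm _ s, mul_left_comm _ (-s), ← Finset.mul_sum] at h1 h2
  change ∑ m, M (.inl x) (.inl m) * v m = (c + c') / 2 * v x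
  apply mul_left_cancel₀ hs
  linear_combination (h1 - h2) / 2

end Restriction

/-! ### Restrictions of `N_V` to the two halves -/

section Main

variable {ι : Type*} [Fintype ι] [DecidableEq ι] {A B : Matrix ι ι ℂ} {d : ℂ}

lemma restrict_inl_mem_nomura_matW (hd : d ≠ 0)
    {M : Matrix ((ι ⊕ ι) ⊕ (ι ⊕ ι)) ((ι ⊕ ι) ⊕ (ι ⊕ ι)) ℂ} (hM : M ∈ nomura (matV d A B)) :
    restrict Function.Embedding.inl M ∈ nomura (matW A B)ᵀ := by
  choose c hc using (hM : ∀ i j, ∃ c : ℂ, M *ᵥ nomuraVec (matV d A B) i j =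
    c • nomuraVec (matV d A B) i j)
  have neg : ∀ {e : (ι ⊕ ι) ⊕ (ι ⊕ ι) → ℂ} {c : ℂ}, M *ᵥ e = c • e → M *ᵥ (-e) = c • (-e) := by
    intro e c h
    rw [mulVec_neg, h, smul_neg]
  rintro (i | i) (j | j)
  · have h1 := hc (.inl (.inl i)) (.inl (.inl j))
    have h2 := hc (.inl (.inl i)) (.inl (.inr j))
    rw [nomuraVec_matV_inl_inl A B _ _ hd] at h1 h2
    simp only [sgn, base, Sum.elim_inl, Sum.elim_inr, id, mul_one, mul_neg] at h1 h2
    rw [nomuraVec_matW_inl_inl]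
    exact exists_restrict_inl_mulVec one_ne_zero h1 h2
  · have h1 := hc (.inl (.inl i)) (.inr (.inl j))
    have h2 := hc (.inl (.inr i)) (.inr (.inl j))
    rw [nomuraVec_matV_inl_inr A B _ _] at h1 h2
    simp only [sgn, base, Sum.elim_inl, Sum.elim_inr, id, one_mul, neg_mul] at h1 h2
    rw [nomuraVec_matW_inl_inr]
    exact exists_restrict_inl_mulVec hd h1 h2
  · have h1 := hc (.inr (.inl i)) (.inl (.inl j))
    have h2 := hc (.inr (.inl i)) (.inl (.inr j))
    rw [nomuraVec_matV_inr_inl A B _ _] at h1 h2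
    simp only [sgn, base, Sum.elim_inl, Sum.elim_inr, id, one_mul, neg_mul] at h1 h2
    rw [nomuraVec_matW_inr_inl]
    exact exists_restrict_inl_mulVec (inv_ne_zero hd) h1 h2
  · have h1 := hc (.inr (.inl i)) (.inr (.inl j))
    -- Here the sign sits on the second half; negating the whole vector moves it to the first.
    have h2 := neg (hc (.inr (.inl i)) (.inr (.inr j)))
    rw [nomuraVec_matV_inr_inr A B _ _ hd] at h1 h2
    rw [← one_smul ℂ (symmVec (nomuraVec B _ _))] at h1 h2
    simp only [sgn, base, Sum.elim_inl, Sum.elim_inr, id, mul_one, mul_neg, ← Sum.elim_neg_neg,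
      neg_smul, neg_neg] at h1 h2
    rw [nomuraVec_matW_inr_inr]
    exact exists_restrict_inl_mulVec one_ne_zero h1 (by rwa [neg_smul])

/-- The restrictions of `N_V` to the first half of the indices form `N_{Wᵀ}`. -/
theorem IsSymmPair.restrict_inl_image (p : IsSymmPair A B) (hd : d ≠ 0) :
    restrict Function.Embedding.inl ''
        (nomura (matV d A B) : Set (Matrix ((ι ⊕ ι) ⊕ (ι ⊕ ι)) ((ι ⊕ ι) ⊕ (ι ⊕ ι)) ℂ)) =
      (nomura (matW A B)ᵀ : Set (Matrix (ι ⊕ ι) (ι ⊕ ι) ℂ)) := by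
  refine Set.Subset.antisymm ?_ ?_
  · rintro _ ⟨M, hM, rfl⟩
    exact restrict_inl_mem_nomura_matW hd hM
  · intro P hP
    obtain ⟨F, G, K, S, hF, hG, rfl⟩ := p.mem_nomura_matW_iff.1 hP
    obtain ⟨F', K', h1, h2, h3⟩ := p.exists_extension_symm hF
    obtain ⟨G', S', h4, h5, h6⟩ := p.exists_extension_skew hG
    -- The extensions were chosen so that the two blocks have equal eigenvalues on the halves of
    -- each Nomura vector of `V`.
    refine ⟨fromBlocks (twist F G) 0 0 (twist F' G'), ?_, rfl⟩
    rintro (x | x) (y | y)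
    · refine ⟨K (base x) (base y), ?_⟩
      rw [nomuraVec_matV_inl_inl A B x y hd, ← one_smul ℂ (symmVec (nomuraVec Bᵀ _ _))]
      refine fromBlocks_mulVec_eq_smul _ _ ?_ ?_
      · rw [twist_mulVec_symmVec, hF.mulVec_nomuraVec, symmVec_smul]
      · rw [twist_mulVec_symmVec, h2.mulVec_nomuraVec, symmVec_smul, transpose_apply]
    · refine ⟨S (base x) (base y), ?_⟩
      rw [nomuraVec_matV_inl_inr]
      refine fromBlocks_mulVec_eq_smul _ _ ?_ ?_
      · rw [twist_mulVec_skewVec, hG.mulVec_eq, skewVec_smul]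
      · rw [twist_mulVec_skewVec, h5.mulVec_eq, skewVec_smul, transpose_apply]
    · refine ⟨S' (base y) (base x), ?_⟩
      rw [nomuraVec_matV_inr_inl]
      refine fromBlocks_mulVec_eq_smul _ _ ?_ ?_
      · rw [twist_mulVec_skewVec, h4.mulVec_eq, skewVec_smul]
      · rw [twist_mulVec_skewVec, h6.mulVec_eq, skewVec_smul, transpose_apply]
    · refine ⟨K' (base y) (base x), ?_⟩
      rw [nomuraVec_matV_inr_inr A B x y hd, ← one_smul ℂ (symmVec (nomuraVec B _ _))]
      refine fromBlocks_mulVec_eq_smul _ _ ?_ ?_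
      · rw [twist_mulVec_symmVec, h1.mulVec_nomuraVec, symmVec_smul]
      · rw [twist_mulVec_symmVec, h3.mulVec_nomuraVec, symmVec_smul, transpose_apply]

lemma submatrix_mem_nomura {κ : Type*} [Fintype κ] [DecidableEq κ] {M V : Matrix κ κ ℂ}
    (e : κ ≃ κ) (h : M ∈ nomura V) : M.submatrix e e ∈ nomura (V.submatrix e e) := by
  intro i j
  obtain ⟨c, hc⟩ := h (e i) (e j)
  refine ⟨c, funext fun k => ?_⟩
  refine Eq.trans ?_ (congrFun hc (e k))
  exact Equiv.sum_comp e fun m => M (e k) m * nomuraVec V (e i) (e j) m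

/-- The diagonal blocks agree and the off-diagonal ones are exchanged, which reduces the second half
to the first for `(A, Bᵀ)`. -/
lemma matV_transpose_submatrix_swap (d : ℂ) (A B : Matrix ι ι ℂ) :
    (matV d A B).submatrix (Equiv.sumComm _ _) (Equiv.sumComm _ _) = matV d A Bᵀ := by
  ext (x | x) (y | y)
  · exact (matV_inr_inr d A B x y).trans (matV_inl_inl d A Bᵀ x y).symm
  · exact (matV_inr_inl d A B x y).trans (matV_inl_inr d A Bᵀ x y).symm
  · exact (matV_inl_inr d A B x y).trans (matV_inr_inl d A Bᵀ x y).symm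
  · exact (matV_inl_inl d A B x y).trans (matV_inr_inr d A Bᵀ x y).symm

lemma restrict_inr_image_subset (d : ℂ) (A B : Matrix ι ι ℂ) :
    restrict Function.Embedding.inr ''
        (nomura (matV d A B) : Set (Matrix ((ι ⊕ ι) ⊕ (ι ⊕ ι)) ((ι ⊕ ι) ⊕ (ι ⊕ ι)) ℂ)) ⊆
      restrict Function.Embedding.inl ''
        (nomura (matV d A Bᵀ) : Set (Matrix ((ι ⊕ ι) ⊕ (ι ⊕ ι)) ((ι ⊕ ι) ⊕ (ι ⊕ ι)) ℂ)) := by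
  rintro _ ⟨M, hM, rfl⟩
  refine ⟨M.submatrix (Equiv.sumComm _ _) (Equiv.sumComm _ _), ?_, rfl⟩
  rw [← matV_transpose_submatrix_swap]
  exact submatrix_mem_nomura _ hM

lemma restrict_inl_image_subset (d : ℂ) (A B : Matrix ι ι ℂ) :
    restrict Function.Embedding.inl ''
        (nomura (matV d A Bᵀ) : Set (Matrix ((ι ⊕ ι) ⊕ (ι ⊕ ι)) ((ι ⊕ ι) ⊕ (ι ⊕ ι)) ℂ)) ⊆
      restrict Function.Embedding.inr ''
        (nomura (matV d A B) : Set (Matrix ((ι ⊕ ι) ⊕ (ι ⊕ ι)) ((ι ⊕ ι) ⊕ (ι ⊕ ι)) ℂ)) := by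
  rintro _ ⟨M, hM, rfl⟩
  refine ⟨M.submatrix (Equiv.sumComm _ _) (Equiv.sumComm _ _), ?_, rfl⟩
  have h := matV_transpose_submatrix_swap d A Bᵀ
  rw [transpose_transpose] at h
  rw [← h]
  exact submatrix_mem_nomura _ hM

/-- The restrictions of `N_V` to the second half of the indices form `N_{Wᵀ}`. -/
theorem IsSymmPair.restrict_inr_image (p : IsSymmPair A B) (hd : d ≠ 0) :
    restrict Function.Embedding.inr ''
        (nomura (matV d A B) : Set (Matrix ((ι ⊕ ι) ⊕ (ι ⊕ ι)) ((ι ⊕ ι) ⊕ (ι ⊕ ι)) ℂ)) =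
      (nomura (matW A B)ᵀ : Set (Matrix (ι ⊕ ι) (ι ⊕ ι) ℂ)) := by
  rw [Set.Subset.antisymm (restrict_inr_image_subset d A B) (restrict_inl_image_subset d A B),
    p.transpose.restrict_inl_image hd, p.nomura_matW_transpose]

end Main

end JonesPair

theorem mainTheorem7 (n : ℕ) (hn : 0 < n) (A B : Matrix (Fin n) (Fin n) ℂ)
    (hA : A.IsSymm) (hAB : JonesPair.IsInvertibleJonesPair A B)
    (d : ℂ) (hd : d ^ 2 = (n : ℂ)) :
    JonesPair.restrict Function.Embedding.inl ''
        (JonesPair.nomura (JonesPair.matV d A B) :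
          Set (Matrix ((Fin n ⊕ Fin n) ⊕ (Fin n ⊕ Fin n))
            ((Fin n ⊕ Fin n) ⊕ (Fin n ⊕ Fin n)) ℂ)) =
      (JonesPair.nomura (JonesPair.matW A B).transpose :
        Set (Matrix (Fin n ⊕ Fin n) (Fin n ⊕ Fin n) ℂ)) ∧
    JonesPair.restrict Function.Embedding.inr ''
        (JonesPair.nomura (JonesPair.matV d A B) :
          Set (Matrix ((Fin n ⊕ Fin n) ⊕ (Fin n ⊕ Fin n))
            ((Fin n ⊕ Fin n) ⊕ (Fin n ⊕ Fin n)) ℂ)) =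
      (JonesPair.nomura (JonesPair.matW A B).transpose :
        Set (Matrix (Fin n ⊕ Fin n) (Fin n ⊕ Fin n) ℂ)) ∧
    ∃ (𝒱 : Finset (Matrix ((Fin n ⊕ Fin n) ⊕ (Fin n ⊕ Fin n))
          ((Fin n ⊕ Fin n) ⊕ (Fin n ⊕ Fin n)) ℂ))
      (𝒲 : Finset (Matrix (Fin n ⊕ Fin n) (Fin n ⊕ Fin n) ℂ)),
      JonesPair.IsSchemeOf 𝒱 (JonesPair.nomura (JonesPair.matV d A B)) ∧
      JonesPair.IsSchemeOf 𝒲 (JonesPair.nomura (JonesPair.matW A B).transpose) ∧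
      JonesPair.IsInducedScheme 𝒱 Function.Embedding.inl 𝒲 ∧
      JonesPair.IsInducedScheme 𝒱 Function.Embedding.inr 𝒲 := by
  have : Nonempty (Fin n) := ⟨⟨0, hn⟩⟩
  have hd0 : d ≠ 0 := by
    rintro rfl
    rw [zero_pow two_ne_zero] at hd
    exact hn.ne' (Nat.cast_eq_zero.1 hd.symm)
  have p := hAB.isSymmPair hA
  have hV := (JonesPair.isTypeII_matV p.left p.right hd0).isSchemeOf_nomura
  have hW := (JonesPair.isTypeII_matW_transpose p.left p.right).isSchemeOf_nomura
  have hl := p.restrict_inl_image hd0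
  have hr := p.restrict_inr_image hd0
  exact ⟨hl, hr, _, _, hV, hW,
    ⟨inferInstance, hV.1, hW.1, JonesPair.schurIdempotents_restrict_image _ _ _ hl⟩,
    ⟨inferInstance, hV.1, hW.1, JonesPair.schurIdempotents_restrict_image _ _ _ hr⟩⟩
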